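/- Let $H$ be a finite-dimensional Hopf algebra over a field $\Bbbk$, with unit map $u$, counit $\varepsilon$, and antipode $S$ (which is bijective). For a Hopf algebra $A$ with bijective antipode $S_A$ and $n \ge 1$, let $m_n : A^{\otimes n} \to A$ and $\Delta_n : A \to A^{\otimes n}$ be the iterated multiplication and comultiplication, and put $$\exp_0(A) = \min\{n \ge 1 \mid m_n \circ \Delta_n = u_A \circ \varepsilon_A\},$$ $$\exp(A) = \min\{n \ge 1 \mid m_n \circ (\mathrm{id} \otimes S_A^{-2} \otimes \cdots \otimes S_A^{-2n+2}) \circ \Delta_n = u_A \circ \varepsilon_A\},$$ where $\min \varnothing = \infty$. Let $\langle S^2 \rangle$ be the group of automorphisms of $H$ generated by $S^2$, and let $H \rtimes \Bbbk\langle S^2 \rangle$ be the Hopf algebra which is $H \otimes \Bbbk\langle S^2 \rangle$ as a coalgebra (the elements of $\langle S^2 \rangle$ being grouplike), with multiplication $(h \rtimes S^{2i})(h' \rtimes S^{2j}) = h\,S^{2i}(h') \rtimes S^{2(i+j)}$, unit $1 \rtimes \mathrm{id}$ and antipode $h \rtimes S^{2i} \mapsto S^{-2i+1}(h) \rtimes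 S^{-2i}$. Then $$\exp(H \rtimes \Bbbk\langle S^2 \rangle) = \mathrm{lcm}(\exp_0(H), \exp(H))$$ as elements of $\{1, 2, 3, \ldots\} \cup \{\infty\}$, where the least common multiple is $\infty$ if at least one of the two exponents is $\infty$. -/

import Mathlib

open scoped TensorProduct

namespace HopfExponent

open Coalgebra Bialgebra HopfAlgebra

/-! ## The antipode -/

section Antipode

variable (k : Type*) (H : Type*) [Field k] [Ring H] [HopfAlgebra k H]

/-- `H` is a Hopf algebra whose antipode is bijective. -/
class BijectiveAntipode : Prop where
  bijective : Function.Bijective (antipode k : H →ₗ[k] H)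

variable {k H}

/-- The antipode is an anti-coalgebra map: `Δ(S(h)) = ∑ S(h₂) ⊗ S(h₁)`. -/
theorem comul_comp_antipode :
    (comul : H →ₗ[k] H ⊗[k] H) ∘ₗ antipode k =
      TensorProduct.map (antipode k) (antipode k) ∘ₗ
        (TensorProduct.comm k H H).toLinearMap ∘ₗ comul := by
  let i₁ : H →ₐ[k] H ⊗[k] H := Algebra.TensorProduct.includeLeft
  let i₂ : H →ₐ[k] H ⊗[k] H := Algebra.TensorProduct.includeRight
  let G : H →ₗ[k] H ⊗[k] H := TensorProduct.map (antipode k) (antipode k) ∘ₗ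
        (TensorProduct.comm k H H).toLinearMap ∘ₗ comul
  have inv (i : H →ₐ[k] H ⊗[k] H) :
      WithConv.toConv (i.toLinearMap ∘ₗ antipode k) * WithConv.toConv i.toLinearMap = 1 := by
    have h := LinearMap.algHom_comp_convMul_distrib i
      (WithConv.toConv (antipode k (A := H))) (WithConv.toConv LinearMap.id)
    rw [LinearMap.antipode_mul_id] at h
    apply WithConv.ofConv_injective
    refine Eq.trans (Eq.trans ?_ h.symm) ?_
    · simp
    · ext x
      simp [LinearMap.convOne_def]
  have hδ : WithConv.toConv (comul : H →ₗ[k] H ⊗[k] H) =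
      WithConv.toConv i₁.toLinearMap * WithConv.toConv i₂.toLinearMap := by
    ext x
    rw [(ℛ k x).convMul_apply]
    simp [i₁, i₂, (ℛ k x).eq]
  have hG : WithConv.toConv G = WithConv.toConv (i₂.toLinearMap ∘ₗ antipode k) *
      WithConv.toConv (i₁.toLinearMap ∘ₗ antipode k) := by
    ext x
    rw [(ℛ k x).convMul_apply]
    simp [i₁, i₂, G, ← (ℛ k x).eq]
  have hleft : WithConv.toConv G * WithConv.toConv (comul : H →ₗ[k] H ⊗[k] H) = 1 := by
    rw [hG, hδ, mul_assoc, ← mul_assoc (WithConv.toConv (i₁.toLinearMap ∘ₗ antipode k)), inv,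
      one_mul, inv]
  exact WithConv.toConv_injective
    (left_inv_eq_right_inv hleft LinearMap.comul_right_inv).symm

/-- A finite-dimensional Hopf algebra has a skew antipode. -/
theorem exists_skewAntipode [FiniteDimensional k H] :
    ∃ T : H →ₗ[k] H, LinearMap.mul' k H ∘ₗ TensorProduct.map T LinearMap.id ∘ₗ
      (TensorProduct.comm k H H).toLinearMap ∘ₗ comul = Algebra.linearMap k H ∘ₗ counit := by
  -- `Ψ T h = ∑ T(h₂) h₁`
  let Ψ : (H →ₗ[k] H) →ₗ[k] (H →ₗ[k] H) :=
    { toFun := fun T => LinearMap.mul' k H ∘ₗ TensorProduct.map T LinearMap.id ∘ₗ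
        (TensorProduct.comm k H H).toLinearMap ∘ₗ comul
      map_add' := fun T T' => by
        simp only [TensorProduct.map_add_left, LinearMap.add_comp, LinearMap.comp_add]
      map_smul' := fun c T => by
        simp only [TensorProduct.map_smul_left, LinearMap.smul_comp, LinearMap.comp_smul,
          RingHom.id_apply] }
  -- `ρ f (a ⊗ b) = f(b) a`
  let ρ (f : H →ₗ[k] k) : H ⊗[k] H →ₗ[k] H := (TensorProduct.rid k H).toLinearMap ∘ₗ f.lTensor H
  let W : Submodule k (H →ₗ[k] H) := LinearMap.range Ψ
  have hid : LinearMap.id ∈ W := by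
    refine ⟨Algebra.linearMap k H ∘ₗ counit, ?_⟩
    ext x
    have := sum_counit_smul (ℛ k x)
    have h2 := congrArg (TensorProduct.rid k H) (sum_tmul_counit_eq (ℛ k x))
    simp only [map_sum, TensorProduct.rid_tmul, one_smul] at h2
    simp only [Ψ, LinearMap.coe_mk, AddHom.coe_mk, LinearMap.comp_apply, ← (ℛ k x).eq, map_sum]
    simpa [← Algebra.smul_def] using h2
  have hL (a : H) (w : H →ₗ[k] H) (hw : w ∈ W) : LinearMap.mulLeft k a ∘ₗ w ∈ W := by
    obtain ⟨T, rfl⟩ := hw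
    refine ⟨LinearMap.mulLeft k a ∘ₗ T, ?_⟩
    ext x
    simp only [Ψ, LinearMap.coe_mk, AddHom.coe_mk, LinearMap.comp_apply, ← (ℛ k x).eq, map_sum]
    simp [mul_assoc]
  have hR (f : H →ₗ[k] k) (w : H →ₗ[k] H) (hw : w ∈ W) : ρ f ∘ₗ comul ∘ₗ w ∈ W := by
    obtain ⟨T, rfl⟩ := hw
    -- `θ (b ⊗ c) = ∑ T(c)₁ f(T(c)₂ b)`
    let θ : H ⊗[k] H →ₗ[k] H := ρ f ∘ₗ LinearMap.mul' k (H ⊗[k] H) ∘ₗ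
      TensorProduct.map (comul ∘ₗ T) (TensorProduct.mk k H H 1) ∘ₗ
        (TensorProduct.comm k H H).toLinearMap
    let Φ : H ⊗[k] (H ⊗[k] H) →ₗ[k] H := LinearMap.mul' k H ∘ₗ
      (TensorProduct.comm k H H).toLinearMap ∘ₗ θ.lTensor H
    have key (a c : H) : ρ f (comul (T c * a)) =
        Φ (TensorProduct.assoc k H H H (comul a ⊗ₜ[k] c)) := by
      rw [Bialgebra.comul_mul, ← (ℛ k a).eq, ← (ℛ k (T c)).eq]
      simp only [Φ, θ, ρ, Finset.mul_sum, TensorProduct.sum_tmul, map_sum,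
        LinearMap.comp_apply, LinearEquiv.coe_coe, TensorProduct.assoc_tmul,
        LinearMap.lTensor_tmul, TensorProduct.comm_tmul, TensorProduct.map_tmul,
        TensorProduct.mk_apply, LinearMap.mul'_apply, ← (ℛ k (T c)).eq, Finset.sum_mul,
        Algebra.TensorProduct.tmul_mul_tmul, TensorProduct.rid_tmul, mul_one, smul_mul_assoc]
    refine ⟨θ ∘ₗ comul, ?_⟩
    ext x
    have hc : TensorProduct.assoc k H H H (comul.rTensor H (comul x)) =
        comul.lTensor H (comul x) := coassoc_apply x
    have h1 : (ρ f ∘ₗ comul ∘ₗ Ψ T) x =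
        Φ (TensorProduct.assoc k H H H (comul.rTensor H (comul x))) := by
      simp only [Ψ, LinearMap.coe_mk, AddHom.coe_mk, LinearMap.comp_apply, ← (ℛ k x).eq, map_sum,
        LinearEquiv.coe_coe, TensorProduct.comm_tmul, TensorProduct.map_tmul, LinearMap.id_apply,
        LinearMap.mul'_apply, LinearMap.rTensor_tmul, key]
    have h2 : Ψ (θ ∘ₗ comul) x = Φ (comul.lTensor H (comul x)) := by
      simp only [Ψ, Φ, LinearMap.coe_mk, AddHom.coe_mk, LinearMap.comp_apply, ← (ℛ k x).eq,
        map_sum, LinearEquiv.coe_coe, TensorProduct.comm_tmul, TensorProduct.map_tmul,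
        LinearMap.id_apply, LinearMap.mul'_apply, LinearMap.lTensor_tmul]
    rw [h1, h2, hc]
  -- `β (x ⊗ y) = ∑ x y₁ ⊗ y₂` is injective
  let β : H ⊗[k] H →ₗ[k] H ⊗[k] H := (LinearMap.mul' k H).rTensor H ∘ₗ
    (TensorProduct.assoc k H H H).symm.toLinearMap ∘ₗ comul.lTensor H
  let β' : H ⊗[k] H →ₗ[k] H ⊗[k] H := (LinearMap.mul' k H).rTensor H ∘ₗ
    (TensorProduct.assoc k H H H).symm.toLinearMap ∘ₗ
      ((antipode k).rTensor H ∘ₗ comul).lTensor H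
  have hβ : β' ∘ₗ β = LinearMap.id := by
    let χ : H ⊗[k] (H ⊗[k] H) →ₗ[k] H ⊗[k] H :=
      (LinearMap.mul' k H ∘ₗ (antipode k).lTensor H).rTensor H ∘ₗ
        (TensorProduct.assoc k H H H).symm.toLinearMap
    ext x y
    let m : H ⊗[k] H →ₗ[k] H ⊗[k] H := (LinearMap.mulLeft k x).rTensor H
    have e1 : β (x ⊗ₜ y) = m (comul y) := by
      simp only [β, m, LinearMap.comp_apply, LinearMap.lTensor_tmul, ← (ℛ k y).eq,
        TensorProduct.tmul_sum, map_sum, LinearEquiv.coe_coe, TensorProduct.assoc_symm_tmul,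
        LinearMap.rTensor_tmul, LinearMap.mul'_apply, LinearMap.mulLeft_apply]
    have e2 (a b : H) : β' (m (a ⊗ₜ b)) = m (χ (a ⊗ₜ comul b)) := by
      simp only [β', χ, m, LinearMap.comp_apply, LinearMap.lTensor_tmul, ← (ℛ k b).eq,
        TensorProduct.tmul_sum, map_sum, LinearEquiv.coe_coe, TensorProduct.assoc_symm_tmul,
        LinearMap.rTensor_tmul, LinearMap.mul'_apply, LinearMap.mulLeft_apply, mul_assoc]
    have e3 : β' (m (comul y)) = m (χ (comul.lTensor H (comul y))) := by
      rw [← (ℛ k y).eq]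
      simp only [map_sum, e2, LinearMap.lTensor_tmul]
    have e4 : χ (comul.lTensor H (comul y)) = 1 ⊗ₜ y := by
      rw [← coassoc_apply]
      have := congrArg (fun z => (Algebra.linearMap k H).rTensor H z) (rTensor_counit_comul y)
      simp only [LinearMap.rTensor_tmul, Algebra.linearMap_apply, map_one] at this
      rw [← this, ← LinearMap.rTensor_comp_apply, ← mul_antipode_lTensor_comul]
      simp [χ, LinearMap.rTensor_comp]
    simp only [TensorProduct.AlgebraTensorModule.curry_apply, LinearMap.restrictScalars_self,
      TensorProduct.curry_apply, LinearMap.comp_apply, LinearMap.id_apply]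
    rw [e1, e3, e4]
    simp [m]
  have hβi : Function.Injective β := fun a b h => by
    simpa using (LinearMap.congr_fun hβ a).symm.trans
      ((congrArg β' h).trans (LinearMap.congr_fun hβ b))
  let lam (f : H →ₗ[k] k) : H ⊗[k] H →ₗ[k] H := (TensorProduct.lid k H).toLinearMap ∘ₗ f.rTensor H
  let U₁ : Submodule k (H →ₗ[k] H ⊗[k] H) :=
    ⨅ f : H →ₗ[k] k, W.comap (LinearMap.compRight k (ρ f))
  let U₂ : Submodule k (H →ₗ[k] H ⊗[k] H) :=
    ⨅ f : H →ₗ[k] k, W.comap (LinearMap.compRight k (lam f))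
  have hle : U₂.map (LinearMap.compRight k β) ≤ U₁ := by
    rintro _ ⟨F, hF, rfl⟩
    have hF' : ∀ f : H →ₗ[k] k, lam f ∘ₗ F ∈ W := by simpa [U₂] using hF
    suffices ∀ f : H →ₗ[k] k, ρ f ∘ₗ β ∘ₗ F ∈ W by simpa [U₁] using this
    intro f
    let b := Module.finBasis k H
    have : ρ f ∘ₗ β ∘ₗ F = ∑ i, LinearMap.mulLeft k (b i) ∘ₗ
        (ρ f ∘ₗ comul ∘ₗ (lam (b.coord i) ∘ₗ F)) := by
      have hb : ρ f ∘ₗ β = ∑ i, LinearMap.mulLeft k (b i) ∘ₗ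
          (ρ f ∘ₗ comul ∘ₗ lam (b.coord i)) := by
        ext x y
        have hx := b.sum_repr x
        have e1 : (ρ f) (β (x ⊗ₜ y)) = x * ρ f (comul y) := by
          simp only [β, ρ, LinearMap.comp_apply, LinearMap.lTensor_tmul, ← (ℛ k y).eq,
            TensorProduct.tmul_sum, map_sum, LinearEquiv.coe_coe, TensorProduct.assoc_symm_tmul,
            LinearMap.rTensor_tmul, LinearMap.mul'_apply, TensorProduct.rid_tmul,
            Finset.mul_sum, mul_smul_comm]
        simp only [TensorProduct.AlgebraTensorModule.curry_apply, LinearMap.restrictScalars_self,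
          TensorProduct.curry_apply, LinearMap.comp_apply, e1, LinearMap.sum_apply]
        conv_lhs => rw [← hx, Finset.sum_mul]
        simp [lam]
      rw [← LinearMap.comp_assoc, hb]
      ext x
      simp
    rw [this]
    exact Submodule.sum_mem _ fun i _ => hL _ _ (hR _ _ (hF' _))
  have hswap : U₂.map (LinearMap.compRight k (TensorProduct.comm k H H).toLinearMap) = U₁ := by
    have hc (f : H →ₗ[k] k) : ρ f ∘ₗ (TensorProduct.comm k H H).toLinearMap = lam f := by
      ext; simp [ρ, lam]
    have hc' (f : H →ₗ[k] k) : lam f ∘ₗ (TensorProduct.comm k H H).toLinearMap = ρ f := by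
      ext; simp [ρ, lam]
    apply le_antisymm
    · rintro _ ⟨F, hF, rfl⟩
      have hF' : ∀ f : H →ₗ[k] k, lam f ∘ₗ F ∈ W := by simpa [U₂] using hF
      suffices ∀ f : H →ₗ[k] k,
        ρ f ∘ₗ (TensorProduct.comm k H H).toLinearMap ∘ₗ F ∈ W by simpa [U₁] using this
      intro f
      rw [← LinearMap.comp_assoc, hc]
      exact hF' f
    · intro F hF
      have hF' : ∀ f : H →ₗ[k] k, ρ f ∘ₗ F ∈ W := by simpa [U₁] using hF
      refine ⟨(TensorProduct.comm k H H).toLinearMap ∘ₗ F, ?_, ?_⟩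
      · suffices ∀ f : H →ₗ[k] k,
          lam f ∘ₗ (TensorProduct.comm k H H).toLinearMap ∘ₗ F ∈ W by simpa [U₂] using this
        intro f
        rw [← LinearMap.comp_assoc, hc']
        exact hF' f
      · ext x
        simp
  have hinj {g : H ⊗[k] H →ₗ[k] H ⊗[k] H} (hg : Function.Injective g) :
      Function.Injective (LinearMap.compRight k (M := H) g) := fun a b h =>
    LinearMap.ext fun x => hg (LinearMap.congr_fun h x)
  have heq : U₂.map (LinearMap.compRight k β) = U₁ := by
    refine Submodule.eq_of_le_of_finrank_eq hle ?_
    rw [← hswap, ← (Submodule.equivMapOfInjective _ (hinj hβi) U₂).finrank_eq,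
      ← (Submodule.equivMapOfInjective _ (hinj (TensorProduct.comm k H H).injective) U₂).finrank_eq]
  have hone : (TensorProduct.mk k H H).flip 1 ∈ U₁ := by
    suffices ∀ f : H →ₗ[k] k, ρ f ∘ₗ (TensorProduct.mk k H H).flip 1 ∈ W by simpa [U₁] using this
    intro f
    convert W.smul_mem (f 1) hid using 1
    ext x
    simp [ρ]
  rw [← heq] at hone
  obtain ⟨F, hF, hFβ⟩ := hone
  have hF' : ∀ f : H →ₗ[k] k, lam f ∘ₗ F ∈ W := by simpa [U₂] using hF
  have hFx : F = (TensorProduct.mk k H H).flip 1 := by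
    apply hinj hβi
    rw [hFβ]
    ext x
    simp [β, Bialgebra.comul_one, Algebra.TensorProduct.one_def]
  obtain ⟨T, hT⟩ := hF' counit
  refine ⟨T, hT.trans ?_⟩
  rw [hFx]
  ext x
  simp [lam, Algebra.algebraMap_eq_smul_one]

/-- The antipode of a finite-dimensional Hopf algebra is bijective. -/
instance [FiniteDimensional k H] : BijectiveAntipode k H where
  bijective := by
    obtain ⟨T, hT⟩ := exists_skewAntipode (k := k) (H := H)
    have h : WithConv.toConv (LinearMap.id : H →ₗ[k] H) =
        WithConv.toConv (antipode k ∘ₗ T) := by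
      refine (left_inv_eq_right_inv (a := WithConv.toConv (antipode k (A := H))) ?_ ?_)
      · simp
      · ext x
        have hx := congrArg (antipode k) (LinearMap.congr_fun hT x)
        rw [(ℛ k x).convMul_apply]
        simp only [LinearMap.comp_apply, ← (ℛ k x).eq, map_sum, LinearEquiv.coe_coe,
          TensorProduct.comm_tmul, TensorProduct.map_tmul, LinearMap.mul'_apply,
          antipode_mul_antidistrib, LinearMap.id_apply, Algebra.linearMap_apply,
          Algebra.algebraMap_eq_smul_one, map_smul, antipode_one] at hx
        simpa [Algebra.algebraMap_eq_smul_one] using hx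
    have hsurj : Function.Surjective (antipode k : H →ₗ[k] H) := fun x =>
      ⟨T x, (LinearMap.congr_fun (WithConv.toConv_injective h) x).symm⟩
    exact ⟨LinearMap.injective_iff_surjective.mpr hsurj, hsurj⟩

variable (k H)

/-- `S²` as an algebra automorphism of `H`. -/
noncomputable def antipodeSq [BijectiveAntipode k H] : H ≃ₐ[k] H :=
  AlgEquiv.ofBijective
    (AlgHom.ofLinearMap (antipode k ∘ₗ antipode k) (by simp)
      (fun x y => by simp [antipode_mul_antidistrib]))
    ((BijectiveAntipode.bijective (k := k) (H := H)).comp BijectiveAntipode.bijective)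

variable {k H}

@[simp]
theorem antipodeSq_apply [BijectiveAntipode k H] (h : H) :
    antipodeSq k H h = antipode k (antipode k h) := rfl

end Antipode

/-! ## The exponents -/

section Exponent

variable (k : Type*) (H : Type*) [Field k] [Ring H] [HopfAlgebra k H]

/-- The iterated multiplication `mₙ : H^{⊗n} → H`, `h₁ ⊗ ⋯ ⊗ hₙ ↦ h₁ ⋯ hₙ`. -/
noncomputable def iterMul (n : ℕ) : (⨂[k]^n) H →ₗ[k] H :=
  PiTensorProduct.lift (MultilinearMap.mkPiAlgebraFin k n H)

/-- The iterated comultiplication `Δₙ : H → H^{⊗n}`, `h ↦ ∑ h₁ ⊗ ⋯ ⊗ hₙ`, with `Δ₀ = ε`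
and `Δₙ₊₁ = (Δₙ ⊗ id) ∘ Δ`. -/
noncomputable def iterComul : (n : ℕ) → H →ₗ[k] (⨂[k]^n) H
  | 0 => TensorPower.algebraMap₀.toLinearMap ∘ₗ counit
  | n + 1 => TensorPower.mulEquiv.toLinearMap ∘ₗ
      TensorProduct.map (iterComul n)
        (PiTensorProduct.subsingletonEquiv (0 : Fin 1)).symm.toLinearMap ∘ₗ comul

/-- The Sweedler power `[n] = mₙ ∘ Δₙ`. -/
noncomputable def sweedlerPower (n : ℕ) : H →ₗ[k] H :=
  iterMul k H n ∘ₗ iterComul k H n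

/-- `mₙ ∘ (id ⊗ S⁻² ⊗ ⋯ ⊗ S⁻²ⁿ⁺²) ∘ Δₙ`. -/
noncomputable def twistedSweedlerPower [BijectiveAntipode k H] (n : ℕ) : H →ₗ[k] H :=
  iterMul k H n ∘ₗ
    PiTensorProduct.map (fun i : Fin n => (antipodeSq k H ^ (-(i : ℤ))).toLinearMap) ∘ₗ
      iterComul k H n

/-- The trivial endomorphism `u ∘ ε`, `h ↦ ε(h) 1`. -/
noncomputable def trivialMap : H →ₗ[k] H := Algebra.linearMap k H ∘ₗ counit

/-- `exp₀(H) = min {n ≥ 1 | [n] = u ∘ ε}`, which is `∞` if there is no such `n`. -/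
noncomputable def exponent₀ : ℕ∞ :=
  sInf ((↑) '' {n : ℕ | 1 ≤ n ∧ sweedlerPower k H n = trivialMap k H})

/-- `exp(H) = min {n ≥ 1 | mₙ ∘ (id ⊗ S⁻² ⊗ ⋯ ⊗ S⁻²ⁿ⁺²) ∘ Δₙ = u ∘ ε}`, which is `∞` if there is
no such `n`. -/
noncomputable def exponent [BijectiveAntipode k H] : ℕ∞ :=
  sInf ((↑) '' {n : ℕ | 1 ≤ n ∧ twistedSweedlerPower k H n = trivialMap k H})

end Exponent

/-- The least common multiple of two elements of `{1, 2, 3, …} ∪ {∞}`, where every positive integer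
and `∞` divide `∞`, and `∞` divides only `∞`. -/
def lcmTop : ℕ∞ → ℕ∞ → ℕ∞
  | (m : ℕ), (n : ℕ) => (Nat.lcm m n : ℕ)
  | _, _ => ⊤

/-! ## The pivotal semidirect product -/

section Pivotal

variable (k : Type*) (H : Type*) [Field k] [Ring H] [HopfAlgebra k H] [BijectiveAntipode k H]

/-- The group `⟨S²⟩` generated by `S²`. -/
abbrev AntipodeSqGroup : Type _ := Subgroup.zpowers (antipodeSq k H)

/-- The semidirect (smash) product `H ⋊ k⟨S²⟩`, realized as the skew group algebra of `⟨S²⟩` over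
`H`: its elements are the finite sums of the elements `h ⋊ g` with `h ∈ H` and `g ∈ ⟨S²⟩`, and its
product is given by `(h ⋊ g) (h' ⋊ g') = h g(h') ⋊ g g'`. -/
def PivotalProduct : Type _ := SkewMonoidAlgebra H (AntipodeSqGroup k H)

noncomputable instance : Ring (PivotalProduct k H) :=
  inferInstanceAs (Ring (SkewMonoidAlgebra H (AntipodeSqGroup k H)))

noncomputable instance : Algebra k (PivotalProduct k H) :=
  inferInstanceAs (Algebra k (SkewMonoidAlgebra H (AntipodeSqGroup k H)))

variable {k H}

theorem comul_comp_antipodeSq :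
    (comul : H →ₗ[k] H ⊗[k] H) ∘ₗ (antipodeSq k H).toLinearMap =
      TensorProduct.map (antipodeSq k H).toLinearMap (antipodeSq k H).toLinearMap ∘ₗ comul := by
  have h : (antipodeSq k H).toLinearMap = antipode k ∘ₗ antipode k := rfl
  rw [h, ← LinearMap.comp_assoc, comul_comp_antipode, LinearMap.comp_assoc, LinearMap.comp_assoc,
    comul_comp_antipode]
  ext x
  simp only [LinearMap.comp_apply, ← (ℛ k x).eq, map_sum, LinearEquiv.coe_coe,
    TensorProduct.comm_tmul, TensorProduct.map_tmul]

/-- The algebra automorphisms of `H` which respect the whole Hopf algebra structure. -/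
def hopfAut (k H : Type*) [Field k] [Ring H] [HopfAlgebra k H] : Subgroup (H ≃ₐ[k] H) where
  carrier := {φ | (∀ h, (comul (φ h) : H ⊗[k] H) =
      TensorProduct.map φ.toLinearMap φ.toLinearMap (comul h)) ∧
    (∀ h, (counit (φ h) : k) = counit h) ∧ ∀ h, antipode k (φ h) = φ (antipode k h)}
  one_mem' := by
    have : (1 : H ≃ₐ[k] H).toLinearMap = LinearMap.id := rfl
    simp [this]
  mul_mem' := by
    rintro φ ψ ⟨h₁, h₂, h₃⟩ ⟨h₁', h₂', h₃'⟩
    have e : (φ * ψ).toLinearMap = φ.toLinearMap ∘ₗ ψ.toLinearMap := rfl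
    refine ⟨fun h => ?_, fun h => ?_, fun h => ?_⟩
    · rw [e, TensorProduct.map_comp, LinearMap.comp_apply, ← h₁', ← h₁, AlgEquiv.mul_apply]
    · rw [AlgEquiv.mul_apply, h₂, h₂']
    · rw [AlgEquiv.mul_apply, AlgEquiv.mul_apply, h₃, h₃']
  inv_mem' := by
    rintro φ ⟨h₁, h₂, h₃⟩
    have e : (φ⁻¹).toLinearMap ∘ₗ φ.toLinearMap = LinearMap.id := by
      ext x
      exact φ.symm_apply_apply x
    refine ⟨fun h => ?_, fun h => ?_, fun h => ?_⟩ <;>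
      obtain ⟨h, rfl⟩ := φ.surjective h <;>
      have hφ (x : H) : φ⁻¹ (φ x) = x := φ.symm_apply_apply x
    · rw [hφ, h₁, ← LinearMap.comp_apply, ← TensorProduct.map_comp, e, TensorProduct.map_id,
        LinearMap.id_apply]
    · rw [hφ, h₂]
    · rw [hφ, h₃, hφ]

theorem mem_hopfAut (g : AntipodeSqGroup k H) : (g : H ≃ₐ[k] H) ∈ hopfAut k H := by
  have h : antipodeSq k H ∈ hopfAut k H :=
    ⟨fun h => LinearMap.congr_fun comul_comp_antipodeSq h, fun h => by simp, fun h => rfl⟩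
  exact (Subgroup.zpowers_le.mpr h) g.2

theorem comul_smul (g : AntipodeSqGroup k H) (h : H) : (comul (g • h) : H ⊗[k] H) =
    TensorProduct.map (g : H ≃ₐ[k] H).toLinearMap (g : H ≃ₐ[k] H).toLinearMap (comul h) :=
  (mem_hopfAut g).1 h

theorem counit_smul (g : AntipodeSqGroup k H) (h : H) : (counit (g • h) : k) = counit h :=
  (mem_hopfAut g).2.1 h

theorem antipode_smul (g : AntipodeSqGroup k H) (h : H) :
    antipode k (g • h) = g • antipode k h :=
  (mem_hopfAut g).2.2 h

/-- The linear map `h ↦ h ⋊ g`. -/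
noncomputable def incl (g : AntipodeSqGroup k H) : H →ₗ[k] PivotalProduct k H where
  toFun h := SkewMonoidAlgebra.single g h
  map_add' x y := SkewMonoidAlgebra.single_add g x y
  map_smul' c x := (SkewMonoidAlgebra.smul_single c g x).symm

theorem incl_mul_incl (g g' : AntipodeSqGroup k H) (x y : H) :
    incl g x * incl g' y = incl (g * g') (x * g • y) :=
  SkewMonoidAlgebra.single_mul_single

theorem one_eq_incl : (1 : PivotalProduct k H) = incl 1 1 := rfl

theorem algebraMap_eq_incl (c : k) :
    algebraMap k (PivotalProduct k H) c = incl 1 (algebraMap k H c) := rfl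

theorem pivotal_induction {p : PivotalProduct k H → Prop} (a : PivotalProduct k H)
    (zero : p 0) (incl : ∀ g h, p (incl g h)) (add : ∀ a b, p a → p b → p (a + b)) : p a :=
  SkewMonoidAlgebra.induction_on a zero incl add

theorem hom_ext {M : Type*} [AddCommMonoid M] [Module k M] {φ ψ : PivotalProduct k H →ₗ[k] M}
    (h : ∀ g x, φ (incl g x) = ψ (incl g x)) : φ = ψ := by
  ext a
  induction a using pivotal_induction with
  | zero => simp
  | incl g x => exact h g x
  | add a b ha hb => rw [map_add, map_add, ha, hb]

/-- The linear map on `H ⋊ k⟨S²⟩` which maps `h ⋊ g` to `f g h`. -/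
noncomputable def liftFun {M : Type*} [AddCommMonoid M] [Module k M]
    (f : AntipodeSqGroup k H → H →ₗ[k] M) : PivotalProduct k H →ₗ[k] M :=
  let e : PivotalProduct k H →ₗ[k] AntipodeSqGroup k H →₀ H :=
    { toFun := SkewMonoidAlgebra.coeff
      map_add' := SkewMonoidAlgebra.coeff_add
      map_smul' := SkewMonoidAlgebra.coeff_smul }
  Finsupp.lsum k f ∘ₗ e

@[simp]
theorem liftFun_incl {M : Type*} [AddCommMonoid M] [Module k M]
    (f : AntipodeSqGroup k H → H →ₗ[k] M) (g : AntipodeSqGroup k H) (h : H) :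
    liftFun f (incl g h) = f g h := by
  change Finsupp.lsum k f (Finsupp.single g h) = f g h
  simp

/-- The coalgebra structure of `H ⊗ k⟨S²⟩`, where the elements of `⟨S²⟩` are grouplike:
`Δ(h ⋊ g) = ∑ (h₁ ⋊ g) ⊗ (h₂ ⋊ g)` and `ε(h ⋊ g) = ε(h)`. -/
noncomputable instance : CoalgebraStruct k (PivotalProduct k H) where
  comul := liftFun fun g => TensorProduct.map (incl g) (incl g) ∘ₗ comul
  counit := liftFun fun _ => counit

@[simp]
theorem comul_incl (g : AntipodeSqGroup k H) (h : H) :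
    (comul (incl g h) : PivotalProduct k H ⊗[k] PivotalProduct k H) =
      TensorProduct.map (incl g) (incl g) (comul h) :=
  liftFun_incl _ g h

@[simp]
theorem counit_incl (g : AntipodeSqGroup k H) (h : H) :
    (counit (incl g h) : k) = counit h :=
  liftFun_incl _ g h

noncomputable instance : Coalgebra k (PivotalProduct k H) where
  coassoc := by
    refine hom_ext fun g x => ?_
    have hc := congrArg (TensorProduct.map (incl g) (TensorProduct.map (incl g) (incl g)))
      (coassoc_apply (R := k) x)
    have e₁ : (comul (R := k)).rTensor (PivotalProduct k H) ∘ₗ TensorProduct.map (incl g) (incl g) =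
        TensorProduct.map (TensorProduct.map (incl g) (incl g)) (incl g) ∘ₗ comul.rTensor H := by
      ext a b
      simp
    have e₂ : (comul (R := k)).lTensor (PivotalProduct k H) ∘ₗ TensorProduct.map (incl g) (incl g) =
        TensorProduct.map (incl g) (TensorProduct.map (incl g) (incl g)) ∘ₗ comul.lTensor H := by
      ext a b
      simp
    simp only [LinearMap.comp_apply, comul_incl, LinearEquiv.coe_coe]
    rw [← LinearMap.comp_apply, e₁, ← LinearMap.comp_apply (comul.lTensor _), e₂,
      LinearMap.comp_apply, LinearMap.comp_apply, ← hc]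
    generalize comul.rTensor H (comul x : H ⊗[k] H) = z
    exact LinearMap.congr_fun (TensorProduct.map_map_comp_assoc_eq _ _ _).symm z
  rTensor_counit_comp_comul := by
    refine hom_ext fun g x => ?_
    have hc := congrArg ((incl g).lTensor k) (rTensor_counit_comul (R := k) x)
    rw [← (ℛ k x).eq] at hc
    simp only [map_sum, LinearMap.lTensor_tmul, LinearMap.rTensor_tmul] at hc
    simpa [← (ℛ k x).eq, -sum_counit_tmul_map_eq] using hc
  lTensor_counit_comp_comul := by
    refine hom_ext fun g x => ?_
    have hc := congrArg ((incl g).rTensor k) (lTensor_counit_comul (R := k) x)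
    rw [← (ℛ k x).eq] at hc
    simp only [map_sum, LinearMap.lTensor_tmul, LinearMap.rTensor_tmul] at hc
    simpa [← (ℛ k x).eq, -sum_map_tmul_counit_eq] using hc

theorem counit_mul_pivotal (a b : PivotalProduct k H) :
    (counit (a * b) : k) = counit a * counit b := by
  induction a using pivotal_induction with
  | zero => simp
  | incl g x =>
    induction b using pivotal_induction with
    | zero => simp
    | incl g' y => simp [incl_mul_incl, counit_smul]
    | add b b' h h' => rw [mul_add, map_add, map_add, h, h', mul_add]
  | add a a' h h' => rw [add_mul, map_add, map_add, h, h', add_mul]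

theorem comul_mul_pivotal (a b : PivotalProduct k H) :
    (comul (a * b) : PivotalProduct k H ⊗[k] PivotalProduct k H) = comul a * comul b := by
  induction a using pivotal_induction with
  | zero => simp
  | incl g x =>
    induction b using pivotal_induction with
    | zero => simp
    | incl g' y =>
      rw [incl_mul_incl, comul_incl, comul_incl, comul_incl,
        Bialgebra.comul_mul, comul_smul, ← (ℛ k x).eq, ← (ℛ k y).eq]
      simp only [map_sum, TensorProduct.map_tmul, Finset.sum_mul_sum,
        Algebra.TensorProduct.tmul_mul_tmul, incl_mul_incl]
      rfl
    | add b b' h h' => rw [mul_add, map_add, map_add, h, h', mul_add]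
  | add a a' h h' => rw [add_mul, map_add, map_add, h, h', add_mul]

noncomputable instance : Bialgebra k (PivotalProduct k H) :=
  Bialgebra.mk' k (PivotalProduct k H)
    (by rw [one_eq_incl, counit_incl, Bialgebra.counit_one])
    (fun {a b} => counit_mul_pivotal a b)
    (by
      rw [one_eq_incl, comul_incl, Bialgebra.comul_one]
      rfl)
    (fun {a b} => comul_mul_pivotal a b)

/-- The antipode of `H ⋊ k⟨S²⟩` is `h ⋊ g ↦ g⁻¹(S(h)) ⋊ g⁻¹`. -/
noncomputable instance : HopfAlgebraStruct k (PivotalProduct k H) where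
  antipode := liftFun fun g => incl g⁻¹ ∘ₗ (g⁻¹ : H ≃ₐ[k] H).toLinearMap ∘ₗ antipode k

@[simp]
theorem antipode_incl (g : AntipodeSqGroup k H) (h : H) :
    antipode k (incl g h) =
      incl g⁻¹ (g⁻¹ • antipode k h) :=
  liftFun_incl _ g h

noncomputable instance : HopfAlgebra k (PivotalProduct k H) where
  mul_antipode_rTensor_comul := by
    refine hom_ext fun g x => ?_
    have hc := congrArg (fun y => incl (1 : AntipodeSqGroup k H) (g⁻¹ • y))
      (mul_antipode_rTensor_comul_apply (R := k) x)
    rw [← (ℛ k x).eq] at hc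
    simp only [map_sum, LinearMap.rTensor_tmul, LinearMap.mul'_apply, Finset.smul_sum, smul_mul',
      smul_algebraMap] at hc
    simp only [LinearMap.comp_apply, comul_incl, counit_incl, ← (ℛ k x).eq, map_sum,
      TensorProduct.map_tmul, LinearMap.rTensor_tmul, LinearMap.mul'_apply,
      antipode_incl, incl_mul_incl, inv_mul_cancel]
    exact hc
  mul_antipode_lTensor_comul := by
    refine hom_ext fun g x => ?_
    have hc := congrArg (fun y => incl (1 : AntipodeSqGroup k H) y)
      (mul_antipode_lTensor_comul_apply (R := k) x)
    rw [← (ℛ k x).eq] at hc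
    simp only [map_sum, LinearMap.lTensor_tmul, LinearMap.mul'_apply] at hc
    simp only [LinearMap.comp_apply, comul_incl, counit_incl, ← (ℛ k x).eq, map_sum,
      TensorProduct.map_tmul, LinearMap.lTensor_tmul, LinearMap.mul'_apply,
      antipode_incl, incl_mul_incl, mul_inv_cancel, smul_inv_smul]
    exact hc

instance : BijectiveAntipode k (PivotalProduct k H) where
  bijective := by
    let e : H ≃ₗ[k] H :=
      LinearEquiv.ofBijective (antipode k) (BijectiveAntipode.bijective (k := k) (H := H))
    let T : PivotalProduct k H →ₗ[k] PivotalProduct k H :=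
      liftFun fun g => incl g⁻¹ ∘ₗ e.symm.toLinearMap ∘ₗ (g⁻¹ : H ≃ₐ[k] H).toLinearMap
    have hT (g : AntipodeSqGroup k H) (h : H) : T (incl g h) =
        incl g⁻¹ (e.symm (g⁻¹ • h)) := liftFun_incl _ g h
    have he (h : H) : antipode k (e.symm h) = h := e.apply_symm_apply h
    have he' (h : H) : e.symm (antipode k h) = h := e.symm_apply_apply h
    have h₁ : antipode k ∘ₗ T = LinearMap.id := by
      refine hom_ext fun g x => ?_
      simp [hT, he]
    have h₂ : T ∘ₗ antipode k = LinearMap.id := by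
      refine hom_ext fun g x => ?_
      simp [hT, he']
    exact Function.bijective_iff_has_inverse.mpr
      ⟨T, LinearMap.congr_fun h₂, LinearMap.congr_fun h₁⟩

end Pivotal

end HopfExponent

/-! Write σ = S² and, for an algebra automorphism τ of H, let Pₙ(τ) = id * τ * ⋯ * τⁿ⁻¹ in the
convolution algebra. The map defining exp₀(H) is Pₙ(1), and the one defining exp(H) is Pₙ(σ⁻¹).
Moving the grouplike factors to the right in H ⋊ k⟨σ⟩ sends h ⋊ g to Pₙ(gσ⁻¹)(h) ⋊ gⁿ. So n is
admissible for the semidirect product iff Pₙ(τ) = 1 and τⁿ = 1 for every τ in ⟨σ⟩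
(`twistedSweedlerPower_pivotalProduct_iff`).

Triviality of Pₙ(τ) is a statement about the order of one element. In the convolution algebra Hom(H,
End H), the element F_τ : h ↦ (x ↦ h τ(x)) satisfies F_τⁿ = 1 iff Pₙ(τ) = 1
(`mulTwist_pow_eq_one_iff`). Hence the n admissible for a given τ are the multiples of the order of
F_τ, and a least common multiple appears once τ = 1 and τ = σ⁻¹ are known to suffice.

They suffice because of Radford's formula for S⁴ (`exists_radford`), which is derived from
integrals. It says that a product w = c a s commutes with F_τ. Here c is left multiplication by a
grouplike g, a is a character α, and s is σ². These factors commute, and each has trivial N-th power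
when P_N(τ) = 1 and σᴺ = 1. Since F_{τσ²} = F_τ s = (F_τ a⁻¹ c⁻¹) w, with both commuting factors of
trivial N-th power, the condition passes from τ to τσ² (`twistedPower_add_two`). The even powers of
σ are reached from 1 and the odd ones from σ⁻¹. -/

namespace HopfExponent

open Coalgebra Bialgebra HopfAlgebra WithConv

/-! ## Twisted Sweedler powers as convolution products -/

section ConvProd

variable {k H : Type*} [Field k] [Ring H] [HopfAlgebra k H]

/-- The convolution product `f₀ * f₁ * ⋯ * fₙ₋₁`. -/
noncomputable def convProd (f : ℕ → H →ₗ[k] H) : ℕ → WithConv (H →ₗ[k] H)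
  | 0 => 1
  | n + 1 => convProd f n * toConv (f n)

theorem iterMul_tprod (n : ℕ) (a : Fin n → H) :
    iterMul k H n (PiTensorProduct.tprod k a) = (List.ofFn a).prod := by
  simp [iterMul]

theorem iterMul_map_mulEquiv (f : ℕ → H →ₗ[k] H) (n : ℕ) (z : (⨂[k]^n) H) (y : H) :
    iterMul k H (n + 1) (PiTensorProduct.map (fun i : Fin (n + 1) => f i)
      (TensorPower.mulEquiv (z ⊗ₜ[k]
        (PiTensorProduct.subsingletonEquiv (R := k) (0 : Fin 1)).symm y))) =
      iterMul k H n (PiTensorProduct.map (fun i : Fin n => f i) z) * f n y := by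
  induction z using PiTensorProduct.induction_on with
  | smul_tprod r a =>
    have h : (PiTensorProduct.subsingletonEquiv (R := k) (0 : Fin 1)).symm y =
        PiTensorProduct.tprod k (fun _ => y) :=
      PiTensorProduct.subsingletonEquiv_symm_apply' _ _
    rw [h, ← TensorProduct.smul_tmul', map_smul, ← TensorPower.gMul_def,
      TensorPower.tprod_mul_tprod]
    simp only [map_smul, PiTensorProduct.map_tprod, iterMul_tprod, smul_mul_assoc]
    rw [List.ofFn_succ', List.concat_eq_append, List.prod_append]
    congr 2
    · congr 2
      ext i
      simp [Fin.append, Fin.addCases]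
    · simp [Fin.append, Fin.addCases]
  | add x y hx hy =>
    rw [TensorProduct.add_tmul, map_add, map_add, map_add, map_add, map_add, hx, hy, add_mul]

/-- This removes the tensor powers: all later computations take place in a convolution algebra. -/
theorem iterMul_map_iterComul (f : ℕ → H →ₗ[k] H) (n : ℕ) :
    iterMul k H n ∘ₗ PiTensorProduct.map (fun i : Fin n => f i) ∘ₗ iterComul k H n =
      (convProd f n).ofConv := by
  induction n with
  | zero =>
    ext x
    simp only [iterComul, LinearMap.comp_apply, convProd, LinearEquiv.coe_coe]
    rw [TensorPower.algebraMap₀_eq_smul_one]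
    simp only [map_smul]
    change _ • iterMul k H 0 (PiTensorProduct.map _ (PiTensorProduct.tprod k Fin.elim0)) = _
    rw [PiTensorProduct.map_tprod, iterMul_tprod]
    simp [LinearMap.convOne_def, Algebra.algebraMap_eq_smul_one]
  | succ n ih =>
    ext x
    change _ = (convProd f n * toConv (f n)) x
    rw [(ℛ k x).convMul_apply]
    simp only [iterComul, LinearMap.comp_apply, ← (ℛ k x).eq, map_sum, TensorProduct.map_tmul,
      LinearEquiv.coe_coe]
    refine Finset.sum_congr rfl fun i _ => ?_
    rw [iterMul_map_mulEquiv]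
    congr 1
    exact LinearMap.congr_fun ih _

/-- `τ⁰ * τ¹ * ⋯ * τⁿ⁻¹`, that is `h ↦ ∑ h₁ τ(h₂) ⋯ τⁿ⁻¹(hₙ)`. -/
noncomputable def twistedPower (τ : H ≃ₐ[k] H) (n : ℕ) : WithConv (H →ₗ[k] H) :=
  convProd (fun i => (τ ^ i).toLinearMap) n

theorem twistedPower_zero (τ : H ≃ₐ[k] H) : twistedPower τ 0 = 1 := rfl

theorem twistedPower_succ (τ : H ≃ₐ[k] H) (n : ℕ) :
    twistedPower τ (n + 1) = twistedPower τ n * toConv (τ ^ n).toLinearMap := rfl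

variable (k H) in
theorem sweedlerPower_eq (n : ℕ) :
    sweedlerPower k H n = (twistedPower (1 : H ≃ₐ[k] H) n).ofConv := by
  rw [twistedPower, ← iterMul_map_iterComul]
  have : (fun i : Fin n => ((1 : H ≃ₐ[k] H) ^ (i : ℕ)).toLinearMap) = fun _ => LinearMap.id := by
    funext i
    rw [one_pow]
    rfl
  rw [this, PiTensorProduct.map_id]
  rfl

variable (k H) in
theorem twistedSweedlerPower_eq [BijectiveAntipode k H] (n : ℕ) :
    twistedSweedlerPower k H n = (twistedPower (antipodeSq k H)⁻¹ n).ofConv := by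
  rw [twistedPower, ← iterMul_map_iterComul, twistedSweedlerPower]
  simp only [zpow_neg, zpow_natCast, inv_pow]

theorem trivialMap_eq : trivialMap k H = (1 : WithConv (H →ₗ[k] H)).ofConv := rfl

variable (k H) in
theorem sweedlerPower_eq_trivialMap_iff (n : ℕ) :
    sweedlerPower k H n = trivialMap k H ↔ twistedPower (1 : H ≃ₐ[k] H) n = 1 := by
  rw [sweedlerPower_eq, trivialMap_eq, ofConv_injective.eq_iff]

variable (k H) in
theorem twistedSweedlerPower_eq_trivialMap_iff [BijectiveAntipode k H] (n : ℕ) :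
    twistedSweedlerPower k H n = trivialMap k H ↔ twistedPower (antipodeSq k H)⁻¹ n = 1 := by
  rw [twistedSweedlerPower_eq, trivialMap_eq, ofConv_injective.eq_iff]

end ConvProd

/-! ### Twisted powers on the semidirect product -/

section Pivotal

variable {k H : Type*} [Field k] [Ring H] [HopfAlgebra k H] [BijectiveAntipode k H]

theorem antipodeSq_incl (g : AntipodeSqGroup k H) (h : H) :
    antipodeSq k (PivotalProduct k H) (incl g h) = incl g (antipodeSq k H h) := by
  simp [antipode_smul]

theorem antipodeSq_inv_pow_incl (n : ℕ) (g : AntipodeSqGroup k H) (h : H) :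
    ((antipodeSq k (PivotalProduct k H))⁻¹ ^ n) (incl g h) =
      incl g (((antipodeSq k H)⁻¹ ^ n) h) := by
  rw [inv_pow, inv_pow]
  have hinv {A : Type _} [Ring A] [Algebra k A] (φ : A ≃ₐ[k] A) (x y : A) :
      φ⁻¹ x = y ↔ x = φ y := φ.toEquiv.symm_apply_eq
  rw [hinv]
  have key (m : ℕ) (x : H) : ((antipodeSq k (PivotalProduct k H)) ^ m) (incl g x) =
      incl g (((antipodeSq k H) ^ m) x) := by
    induction m generalizing x with
    | zero => rfl
    | succ m ih => rw [pow_succ, pow_succ, AlgEquiv.mul_apply, AlgEquiv.mul_apply,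
        antipodeSq_incl, ih]
  rw [key]
  congr 1
  exact (((antipodeSq k H) ^ n).apply_symm_apply h).symm

/-- The factor with index i is σ⁻ⁱ(hᵢ) ⋊ g. Moving the i preceding copies of g past it replaces σ⁻ⁱ
by gⁱσ⁻ⁱ, which is (gσ⁻¹)ⁱ because ⟨σ⟩ is commutative. -/
theorem twistedPower_incl (n : ℕ) (g : AntipodeSqGroup k H) (h : H) :
    twistedPower (antipodeSq k (PivotalProduct k H))⁻¹ n (incl g h) =
      incl (g ^ n) (twistedPower ((g : H ≃ₐ[k] H) * (antipodeSq k H)⁻¹) n h) := by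
  have hcomm : Commute (g : H ≃ₐ[k] H) (antipodeSq k H)⁻¹ := by
    obtain ⟨_, m, rfl⟩ := g
    exact ((Commute.refl (antipodeSq k H)).zpow_left m).inv_right
  induction n generalizing h with
  | zero =>
    rw [twistedPower_zero, twistedPower_zero, pow_zero, LinearMap.convOne_apply,
      LinearMap.convOne_apply, counit_incl, algebraMap_eq_incl]
  | succ n ih =>
    rw [twistedPower_succ, twistedPower_succ, (ℛ k h).convMul_apply, map_sum,
      LinearMap.convMul_apply, comul_incl]
    simp only [← (ℛ k h).eq, map_sum, TensorProduct.map_tmul, LinearMap.mul'_apply]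
    refine Finset.sum_congr rfl fun i _ => ?_
    refine (congrArg₂ (· * ·) (ih _) (antipodeSq_inv_pow_incl n g _)).trans ?_
    rw [incl_mul_incl, ← pow_succ]
    congr 2
    rw [hcomm.mul_pow]
    rfl

theorem eq_of_incl_eq_incl {g g' : AntipodeSqGroup k H} {x y : H} (hy : y ≠ 0)
    (h : incl g x = incl g' y) : g = g' ∧ x = y := by
  have h' : Finsupp.single g x = Finsupp.single g' y := congrArg SkewMonoidAlgebra.coeff h
  rcases (Finsupp.single_eq_single_iff _ _ _ _).mp h' with h | h
  · exact h
  · exact absurd h.2 hy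

theorem incl_injective (g : AntipodeSqGroup k H) : Function.Injective (incl g) :=
  SkewMonoidAlgebra.single_injective g

/-- As g runs through ⟨σ⟩, so does gσ⁻¹. The two conditions are the H-component and the group
component of `twistedPower_incl`. -/
theorem twistedSweedlerPower_pivotalProduct_iff (n : ℕ) :
    twistedSweedlerPower k (PivotalProduct k H) n = trivialMap k (PivotalProduct k H) ↔
      ∀ τ ∈ Subgroup.zpowers (antipodeSq k H), twistedPower τ n = 1 ∧ τ ^ n = 1 := by
  have : Nontrivial H := (counitAlgHom k H).toRingHom.domain_nontrivial
  rw [twistedSweedlerPower_eq_trivialMap_iff]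
  constructor
  · intro h
    have key (g : AntipodeSqGroup k H) (x : H) :
        incl (g ^ n) (twistedPower ((g : H ≃ₐ[k] H) * (antipodeSq k H)⁻¹) n x) =
          incl 1 (algebraMap k H (counit x)) := by
      rw [← twistedPower_incl, h, LinearMap.convOne_apply, counit_incl, algebraMap_eq_incl]
    -- At x = 1 the right-hand side of `key` is the nonzero element 1 ⋊ 1, so the group components
    -- must agree.
    have hpow (g : AntipodeSqGroup k H) : g ^ n = 1 :=
      (eq_of_incl_eq_incl (by simp) (key g 1)).1
    intro τ hτ
    refine ⟨?_, congrArg Subtype.val (hpow ⟨τ, hτ⟩)⟩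
    ext x
    have hx := key ⟨τ * antipodeSq k H, mul_mem hτ (Subgroup.mem_zpowers _)⟩ x
    rw [hpow, mul_inv_cancel_right] at hx
    exact incl_injective _ hx
  · intro h
    apply ofConv_injective
    refine hom_ext fun g x => ?_
    have hg := h _ (mul_mem g.2 (inv_mem (Subgroup.mem_zpowers (antipodeSq k H))))
    have hg1 : g ^ n = 1 := Subtype.ext (h _ g.2).2
    rw [twistedPower_incl, hg.1, hg1, LinearMap.convOne_apply, LinearMap.convOne_apply,
      counit_incl, algebraMap_eq_incl]

end Pivotal

/-! ## The actions of functionals -/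

section Hit

variable {k H : Type*} [Field k] [Ring H] [HopfAlgebra k H]

/-- `x ↦ ∑ f(x₂) x₁`. -/
noncomputable def rhit (f : H →ₗ[k] k) : H →ₗ[k] H :=
  (TensorProduct.rid k H).toLinearMap ∘ₗ f.lTensor H ∘ₗ comul

/-- `x ↦ ∑ f(x₁) x₂`. -/
noncomputable def lhit (f : H →ₗ[k] k) : H →ₗ[k] H :=
  (TensorProduct.lid k H).toLinearMap ∘ₗ f.rTensor H ∘ₗ comul

theorem rhit_apply {ι : Type*} (f : H →ₗ[k] k) {x : H} (r : Coalgebra.Repr k x ι) :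
    rhit f x = ∑ i ∈ r.index, f (r.right i) • r.left i := by
  simp [rhit, ← r.eq]

theorem lhit_apply {ι : Type*} (f : H →ₗ[k] k) {x : H} (r : Coalgebra.Repr k x ι) :
    lhit f x = ∑ i ∈ r.index, f (r.left i) • r.right i := by
  simp [lhit, ← r.eq]

theorem rhit_mul (f : H →ₗ[k] k) (x y : H) : rhit f (x * y) =
    ∑ i ∈ (ℛ k x).index, ∑ j ∈ (ℛ k y).index,
      f ((ℛ k x).right i * (ℛ k y).right j) • ((ℛ k x).left i * (ℛ k y).left j) := by
  simp only [rhit, LinearMap.comp_apply, Bialgebra.comul_mul]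
  conv_lhs => rw [← (ℛ k x).eq, ← (ℛ k y).eq, Finset.sum_mul_sum]
  simp

theorem lhit_mul (f : H →ₗ[k] k) (x y : H) : lhit f (x * y) =
    ∑ i ∈ (ℛ k x).index, ∑ j ∈ (ℛ k y).index,
      f ((ℛ k x).left i * (ℛ k y).left j) • ((ℛ k x).right i * (ℛ k y).right j) := by
  simp only [lhit, LinearMap.comp_apply, Bialgebra.comul_mul]
  conv_lhs => rw [← (ℛ k x).eq, ← (ℛ k y).eq, Finset.sum_mul_sum]
  simp

/-- `rhit f` is the transpose of right convolution by f, and `lhit f` that of left convolution.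
Identities between them thus follow from associativity in the dual, by testing against functionals.
-/
theorem apply_rhit (f p : H →ₗ[k] k) (x : H) :
    p (rhit f x) = (toConv p * toConv f : WithConv (H →ₗ[k] k)) x := by
  rw [rhit_apply f (ℛ k x), (ℛ k x).convMul_apply]
  simp [mul_comm]

theorem apply_lhit (f p : H →ₗ[k] k) (x : H) :
    p (lhit f x) = (toConv f * toConv p : WithConv (H →ₗ[k] k)) x := by
  rw [lhit_apply f (ℛ k x), (ℛ k x).convMul_apply]
  simp

theorem eq_of_forall_dual {V : Type*} [AddCommGroup V] [Module k V] {x y : V}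
    (h : ∀ p : V →ₗ[k] k, p x = p y) : x = y := by
  rw [← sub_eq_zero, ← Module.forall_dual_apply_eq_zero_iff k]
  intro p
  rw [map_sub, h, sub_self]

theorem rhit_convMul (p f : H →ₗ[k] k) (x : H) :
    rhit (toConv p * toConv f : WithConv (H →ₗ[k] k)).ofConv x = rhit p (rhit f x) := by
  refine eq_of_forall_dual (k := k) fun q => ?_
  have h := apply_rhit f (toConv q * toConv p : WithConv (H →ₗ[k] k)).ofConv x
  rw [apply_rhit, apply_rhit, toConv_ofConv, ← mul_assoc]
  exact h.symm

theorem lhit_rhit (p f : H →ₗ[k] k) (x : H) : lhit p (rhit f x) = rhit f (lhit p x) := by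
  refine eq_of_forall_dual (k := k) fun q => ?_
  have h1 := apply_rhit f (toConv p * toConv q : WithConv (H →ₗ[k] k)).ofConv x
  have h2 := apply_lhit p (toConv q * toConv f : WithConv (H →ₗ[k] k)).ofConv x
  rw [toConv_ofConv] at h1 h2
  rw [apply_lhit, h1, mul_assoc, ← h2, ← apply_rhit]

theorem rhit_counit (x : H) : rhit (counit : H →ₗ[k] k) x = x := by
  simp [rhit]

theorem lhit_counit (x : H) : lhit (counit : H →ₗ[k] k) x = x := by
  simp [lhit]

theorem comul_lhit (f : H →ₗ[k] k) (x : H) :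
    comul (lhit f x) = (lhit f).rTensor H (comul x) := by
  have h := congrArg (fun z => (TensorProduct.lid k (H ⊗[k] H)) (f.rTensor (H ⊗[k] H) z))
    (coassoc_apply (R := k) x)
  have e1 (z : H ⊗[k] H) : (TensorProduct.lid k (H ⊗[k] H)) (f.rTensor (H ⊗[k] H)
      (comul.lTensor H z)) = comul ((TensorProduct.lid k H) (f.rTensor H z)) := by
    induction z using TensorProduct.induction_on with
    | zero => simp
    | tmul a b => simp
    | add a b ha hb => simp only [map_add, ha, hb]
  have e2 (z : H ⊗[k] H) : (TensorProduct.lid k (H ⊗[k] H)) (f.rTensor (H ⊗[k] H)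
      (TensorProduct.assoc k H H H (comul.rTensor H z))) = (lhit f).rTensor H z := by
    induction z using TensorProduct.induction_on with
    | zero => simp
    | tmul a b =>
      rw [LinearMap.rTensor_tmul, LinearMap.rTensor_tmul, lhit_apply f (ℛ k a)]
      conv_lhs => rw [← (ℛ k a).eq]
      simp [TensorProduct.sum_tmul, TensorProduct.smul_tmul']
    | add a b ha hb => simp only [map_add, ha, hb]
  rw [e1, e2] at h
  exact h.symm

/-- `∑ y₁ f(x y₂) = ∑ S(x₁) (x₂ y)₁ f((x₂ y)₂)`. -/
theorem rhit_comp_mulLeft (f : H →ₗ[k] k) (x y : H) :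
    rhit (f ∘ₗ LinearMap.mulLeft k x) y =
      (toConv (antipode k) * toConv (rhit f ∘ₗ LinearMap.mulRight k y) :
        WithConv (H →ₗ[k] H)) x := by
  let G : H →ₗ[k] H :=
    { toFun := fun x => rhit (f ∘ₗ LinearMap.mulLeft k x) y
      map_add' := fun a b => by
        simp only [rhit_apply _ (ℛ k y)]
        simp [add_mul, add_smul, Finset.sum_add_distrib]
      map_smul' := fun c a => by
        simp only [rhit_apply _ (ℛ k y)]
        simp [mul_smul, Finset.smul_sum] }
  -- Since Δ is multiplicative, convolving with `id` gives ∑ x₁y₁ f(x₂y₂); the antipode then cancels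
  -- `id`.
  have h : (toConv LinearMap.id * toConv G : WithConv (H →ₗ[k] H)) =
      toConv (rhit f ∘ₗ LinearMap.mulRight k y) := by
    ext x
    rw [(ℛ k x).convMul_apply]
    simp only [G, LinearMap.coe_mk, AddHom.coe_mk, LinearMap.comp_apply,
      rhit_apply _ (ℛ k y), LinearMap.id_apply, LinearMap.mulLeft_apply, LinearMap.mulRight_apply]
    rw [rhit_mul]
    simp [Finset.mul_sum]
  rw [← h, ← mul_assoc, LinearMap.antipode_mul_id, one_mul]
  rfl

/-- `∑ f(x y₁) S(y₂) = ∑ S(f((x₁ y)₁) (x₁ y)₂) x₂`. -/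
theorem antipode_lhit_comp_mulLeft (f : H →ₗ[k] k) (x y : H) :
    antipode k (lhit (f ∘ₗ LinearMap.mulLeft k x) y) =
      (toConv (antipode k ∘ₗ lhit f ∘ₗ LinearMap.mulRight k y) * toConv LinearMap.id :
        WithConv (H →ₗ[k] H)) x := by
  let G : H →ₗ[k] H :=
    { toFun := fun x => antipode k (lhit (f ∘ₗ LinearMap.mulLeft k x) y)
      map_add' := fun a b => by
        simp only [lhit_apply _ (ℛ k y)]
        simp [add_mul, add_smul, Finset.sum_add_distrib]
      map_smul' := fun c a => by
        simp only [lhit_apply _ (ℛ k y)]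
        simp [mul_smul, Finset.smul_sum] }
  have h : (toConv G * toConv (antipode k) : WithConv (H →ₗ[k] H)) =
      toConv (antipode k ∘ₗ lhit f ∘ₗ LinearMap.mulRight k y) := by
    ext x
    rw [(ℛ k x).convMul_apply]
    simp only [G, LinearMap.coe_mk, AddHom.coe_mk, LinearMap.comp_apply,
      lhit_apply _ (ℛ k y), LinearMap.mulLeft_apply, LinearMap.mulRight_apply]
    rw [lhit_mul]
    simp [Finset.sum_mul, antipode_mul_antidistrib]
  rw [← h, mul_assoc, LinearMap.antipode_mul_id, mul_one]
  rfl

end Hit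

/-! ## Integrals -/

section Integral

variable {k H : Type*} [Field k] [Ring H] [HopfAlgebra k H]

variable (k) in
/-- `t` is a left integral of `H`. -/
def IsLeftIntegral (t : H) : Prop := ∀ h : H, h * t = (counit h : k) • t

/-- The map `c ⊗ v ↦ ∑ c₁ ⊗ A(c₂) v` on `H ⊗ V`. -/
noncomputable def twist {V : Type*} [AddCommGroup V] [Module k V] (A : H →ₗ[k] Module.End k V) :
    H ⊗[k] V →ₗ[k] H ⊗[k] V :=
  (TensorProduct.lift A).lTensor H ∘ₗ (TensorProduct.assoc k H H V).toLinearMap ∘ₗ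
    (comul : H →ₗ[k] H ⊗[k] H).rTensor V

theorem twist_tmul {V : Type*} [AddCommGroup V] [Module k V] (A : H →ₗ[k] Module.End k V)
    {ι : Type*} {c : H} (r : Coalgebra.Repr k c ι) (v : V) :
    twist A (c ⊗ₜ v) = ∑ i ∈ r.index, r.left i ⊗ₜ A (r.right i) v := by
  simp [twist, ← r.eq, TensorProduct.sum_tmul]

theorem twist_one {V : Type*} [AddCommGroup V] [Module k V] :
    twist (1 : WithConv (H →ₗ[k] Module.End k V)).ofConv = LinearMap.id := by
  refine TensorProduct.ext' fun c v => ?_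
  have := congrArg (fun z => z ⊗ₜ[k] v) (rhit_counit (k := k) c)
  rw [rhit_apply _ (ℛ k c)] at this
  simp only [TensorProduct.sum_tmul] at this
  rw [twist_tmul _ (ℛ k c)]
  simpa [LinearMap.convOne_def, Algebra.algebraMap_eq_smul_one, TensorProduct.smul_tmul] using this

/-- By coassociativity `twist` turns convolution into composition, so convolution inverses give
inverse twists. -/
theorem twist_twist {V : Type*} [AddCommGroup V] [Module k V] (A B : H →ₗ[k] Module.End k V) :
    twist A ∘ₗ twist B = twist (toConv A * toConv B : WithConv (H →ₗ[k] Module.End k V)).ofConv := by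
  refine TensorProduct.ext' fun c v => ?_
  let m : H ⊗[k] H →ₗ[k] V := LinearMap.applyₗ v ∘ₗ LinearMap.mul' k (Module.End k V) ∘ₗ
    TensorProduct.map A B
  have hc := congrArg (m.lTensor H) (coassoc_apply (R := k) c)
  have e1 : twist (toConv A * toConv B : WithConv (H →ₗ[k] Module.End k V)).ofConv (c ⊗ₜ v) =
      m.lTensor H (comul.lTensor H (comul c)) := by
    rw [twist_tmul _ (ℛ k c)]
    conv_rhs => rw [← (ℛ k c).eq]
    simp [m]
  have e2 (a b : H) : twist A (a ⊗ₜ B b v) =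
      m.lTensor H (TensorProduct.assoc k H H H (comul a ⊗ₜ b)) := by
    rw [twist_tmul _ (ℛ k a), ← (ℛ k a).eq]
    simp [m, TensorProduct.sum_tmul]
  rw [e1, ← hc, LinearMap.comp_apply, twist_tmul _ (ℛ k c)]
  conv_rhs => rw [← (ℛ k c).eq]
  simp [e2]

theorem twist_antipode_twist {V : Type*} [AddCommGroup V] [Module k V]
    (ρ : H →ₐ[k] Module.End k V) :
    twist ρ.toLinearMap ∘ₗ twist (ρ.toLinearMap ∘ₗ antipode k) = LinearMap.id ∧
      twist (ρ.toLinearMap ∘ₗ antipode k) ∘ₗ twist ρ.toLinearMap = LinearMap.id := by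
  have h1 := LinearMap.algHom_comp_convMul_distrib ρ (toConv LinearMap.id)
    (toConv (antipode k (A := H)))
  have h2 := LinearMap.algHom_comp_convMul_distrib ρ (toConv (antipode k (A := H)))
    (toConv LinearMap.id)
  have h3 : ρ.toLinearMap ∘ₗ (1 : WithConv (H →ₗ[k] H)).ofConv =
      (1 : WithConv (H →ₗ[k] Module.End k V)).ofConv := by
    ext x
    simp [LinearMap.convOne_def]
  rw [LinearMap.id_mul_antipode, h3] at h1
  rw [LinearMap.antipode_mul_id, h3] at h2
  rw [twist_twist, twist_twist, ← twist_one]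
  constructor
  · exact congrArg twist h1.symm
  · exact congrArg twist h2.symm

/-- The diagonal action of `H` on `H ⊗ V`. -/
noncomputable def diag {V : Type*} [AddCommGroup V] [Module k V] (A : H →ₗ[k] Module.End k V)
    (h : H) : H ⊗[k] V →ₗ[k] H ⊗[k] V :=
  ∑ i ∈ (ℛ k h).index, TensorProduct.map (LinearMap.mulLeft k ((ℛ k h).left i))
    (A ((ℛ k h).right i))

/-- With `twist_antipode_twist`, this identifies the diagonal module H ⊗ V with the module on which
H acts on the first factor only. -/
theorem twist_mulLeft {V : Type*} [AddCommGroup V] [Module k V] (ρ : H →ₐ[k] Module.End k V)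
    (h : H) : twist ρ.toLinearMap ∘ₗ (LinearMap.mulLeft k h).rTensor V =
      diag ρ.toLinearMap h ∘ₗ twist ρ.toLinearMap := by
  refine TensorProduct.ext' fun c v => ?_
  have h1 : twist ρ.toLinearMap ((h * c) ⊗ₜ v) = ∑ i ∈ (ℛ k h).index, ∑ j ∈ (ℛ k c).index,
      ((ℛ k h).left i * (ℛ k c).left j) ⊗ₜ[k] (ρ ((ℛ k h).right i * (ℛ k c).right j) v) := by
    simp only [twist, LinearMap.comp_apply, LinearMap.rTensor_tmul, Bialgebra.comul_mul]
    conv_lhs => rw [← (ℛ k h).eq, ← (ℛ k c).eq, Finset.sum_mul_sum]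
    simp [TensorProduct.sum_tmul]
  rw [LinearMap.comp_apply, LinearMap.comp_apply, LinearMap.rTensor_tmul,
    LinearMap.mulLeft_apply, h1, twist_tmul _ (ℛ k c)]
  rw [Finset.sum_comm]
  simp [diag, LinearMap.sum_apply]

variable (k H) in
/-- The dual of the regular representation, `(a f)(x) = f(S(a) x)`. -/
noncomputable def dualRep : H →ₐ[k] Module.End k (Module.Dual k H) :=
  AlgHom.ofLinearMap
    { toFun := fun a => (LinearMap.mulLeft k (antipode k a)).dualMap
      map_add' := fun a b => by
        ext f x
        simp [add_mul]
      map_smul' := fun c a => by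
        ext f x
        simp }
    (by
      ext f x
      simp)
    (fun a b => by
      ext f x
      simp [antipode_mul_antidistrib])

theorem dualRep_apply (a : H) (f : Module.Dual k H) (x : H) :
    dualRep k H a f x = f (antipode k a * x) := rfl

/-- Under H ⊗ H* ≅ End H the identity is a nonzero invariant of the diagonal action. Untwisting it
gives an invariant for the action on the first factor, and any nonzero value of the corresponding
endomorphism is an integral. -/
theorem exists_isLeftIntegral [FiniteDimensional k H] : ∃ t : H, t ≠ 0 ∧ IsLeftIntegral k t := by
  have : Nontrivial H := (counitAlgHom k H).toRingHom.domain_nontrivial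
  let E : H ⊗[k] Module.Dual k H ≃ₗ[k] (H →ₗ[k] H) :=
    (TensorProduct.comm k H (Module.Dual k H)).trans (dualTensorHomEquiv k H H)
  have hE (c : H) (f : Module.Dual k H) (x : H) : E (c ⊗ₜ f) x = f x • c := by
    simp [E]
  obtain ⟨h12, h21⟩ := twist_antipode_twist (dualRep k H)
  have hdiag (h : H) (w : H ⊗[k] Module.Dual k H) (x : H) :
      E (diag (dualRep k H).toLinearMap h w) x =
        ∑ i ∈ (ℛ k h).index, (ℛ k h).left i * E w (antipode k ((ℛ k h).right i) * x) := by
    induction w using TensorProduct.induction_on with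
    | zero => simp
    | tmul c f => simp [diag, LinearMap.sum_apply, map_sum, hE, dualRep_apply]
    | add a b ha hb => simp [ha, hb, mul_add, Finset.sum_add_distrib]
  have hinv (h : H) : diag (dualRep k H).toLinearMap h (E.symm LinearMap.id) =
      (counit h : k) • E.symm LinearMap.id := by
    apply E.injective
    ext x
    rw [hdiag]
    have := congrArg (· * x) (sum_mul_antipode_eq_smul (R := k) (ℛ k h))
    simpa [Finset.sum_mul, mul_assoc] using this
  let z := twist ((dualRep k H).toLinearMap ∘ₗ antipode k) (E.symm LinearMap.id)
  have hz : twist (dualRep k H).toLinearMap z = E.symm LinearMap.id :=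
    LinearMap.congr_fun h12 _
  have hz0 : z ≠ 0 := by
    intro h0
    rw [h0, map_zero] at hz
    have h1 := LinearMap.congr_fun (E.symm.map_eq_zero_iff.mp hz.symm) (1 : H)
    simp at h1
  have hmul (h : H) : (LinearMap.mulLeft k h).rTensor (Module.Dual k H) z =
      (counit h : k) • z := by
    have hi : Function.Injective (twist (dualRep k H).toLinearMap) :=
      Function.LeftInverse.injective (g := twist ((dualRep k H).toLinearMap ∘ₗ antipode k))
        (LinearMap.congr_fun h21)
    apply hi
    rw [← LinearMap.comp_apply, twist_mulLeft, LinearMap.comp_apply, hz, hinv, map_smul, hz]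
  have hF (h : H) (w : H ⊗[k] Module.Dual k H) (x : H) :
      E ((LinearMap.mulLeft k h).rTensor (Module.Dual k H) w) x = h * E w x := by
    induction w using TensorProduct.induction_on with
    | zero => simp
    | tmul c f => simp [hE]
    | add a b ha hb => simp [ha, hb, mul_add]
  obtain ⟨x, hx⟩ : ∃ x, E z x ≠ 0 := by
    by_contra! hc
    exact hz0 (E.map_eq_zero_iff.mp (LinearMap.ext hc))
  refine ⟨E z x, hx, fun h => ?_⟩
  rw [← hF, hmul, map_smul, LinearMap.smul_apply]

end Integral

section Integral

variable {k H : Type*} [Field k] [Ring H] [HopfAlgebra k H]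

variable (k) in
/-- `f ↦ ∑ f(t₂) t₁` as a linear map on the dual. -/
noncomputable def dualToSelf (t : H) : (H →ₗ[k] k) →ₗ[k] H where
  toFun f := rhit f t
  map_add' f g := by
    simp [rhit_apply _ (ℛ k t), add_smul, Finset.sum_add_distrib]
  map_smul' c f := by
    simp [rhit_apply _ (ℛ k t), mul_smul, Finset.smul_sum]

@[simp]
theorem dualToSelf_apply (t : H) (f : H →ₗ[k] k) : dualToSelf k t f = rhit f t := rfl

theorem IsLeftIntegral.rhit_comp_mulLeft {t : H} (ht : IsLeftIntegral k t) (f : H →ₗ[k] k)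
    (x : H) : rhit (f ∘ₗ LinearMap.mulLeft k x) t = antipode k x * rhit f t := by
  rw [HopfExponent.rhit_comp_mulLeft, (ℛ k x).convMul_apply]
  have := congrArg (fun z => antipode k z * rhit f t) (rhit_counit (k := k) x)
  rw [rhit_apply _ (ℛ k x)] at this
  simpa [ht _, Finset.sum_mul] using this

/-- The kernel is stable under f ↦ f(x ·), so it is enough that f(1) = 0 for f in it. -/
theorem IsLeftIntegral.dualToSelf_injective [FiniteDimensional k H] {t : H}
    (ht : IsLeftIntegral k t) (ht0 : t ≠ 0) : Function.Injective (dualToSelf k t) := by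
  rw [← LinearMap.ker_eq_bot, LinearMap.ker_eq_bot']
  intro f hf
  rw [dualToSelf_apply] at hf
  have h1 (x : H) : rhit (f ∘ₗ LinearMap.mulLeft k x) t = 0 := by
    rw [ht.rhit_comp_mulLeft, hf, mul_zero]
  have h2 (f : H →ₗ[k] k) (hf : ∀ x, rhit (f ∘ₗ LinearMap.mulLeft k x) t = 0) : f 1 = 0 := by
    let b := Module.finBasis k H
    -- This is f(∑ S(y₁)y₂) = ε(y) f(1) with S(y₁) expanded in a basis. Acting on t, the right-hand
    -- side vanishes and the left-hand side is f(1) t.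
    have e : f 1 • (counit : H →ₗ[k] k) = ∑ i, (toConv (b.coord i ∘ₗ antipode k) *
        toConv (f ∘ₗ LinearMap.mulLeft k (b i)) : WithConv (H →ₗ[k] k)).ofConv := by
      ext y
      have hy := congrArg f (sum_antipode_mul_eq_smul (R := k) (ℛ k y))
      have hs (a c : H) : f (antipode k a * c) = ∑ i, b.coord i (antipode k a) * f (b i * c) := by
        conv_lhs => rw [← b.sum_repr (antipode k a), Finset.sum_mul, map_sum]
        simp
      rw [LinearMap.sum_apply]
      simp only [(ℛ k y).convMul_apply]
      rw [Finset.sum_comm]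
      simp only [map_sum, hs, map_smul] at hy
      simpa [mul_comm] using hy.symm
    have e2 := congrArg (dualToSelf k t) e
    rw [map_sum, map_smul, dualToSelf_apply, rhit_counit] at e2
    simp only [dualToSelf_apply, rhit_convMul, hf, map_zero, Finset.sum_const_zero] at e2
    exact (smul_eq_zero.mp e2).resolve_right ht0
  ext x
  have := h2 (f ∘ₗ LinearMap.mulLeft k x) (fun y => by
    have e : (f ∘ₗ LinearMap.mulLeft k x) ∘ₗ LinearMap.mulLeft k y =
        f ∘ₗ LinearMap.mulLeft k (x * y) := by
      ext z
      simp
    rw [e, h1])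
  simpa using this

/-- A left integral `t` of `H` and a left integral `lam` of the dual of `H` with `lam t = 1`, where
`t` is nondegenerate. -/
structure IsIntegralPair (lam : H →ₗ[k] k) (t : H) : Prop where
  isLeftIntegral : IsLeftIntegral k t
  rhit_eq (x : H) : rhit lam x = algebraMap k H (lam x)
  apply_eq_one : lam t = 1
  injective : Function.Injective (dualToSelf k t)

/-- By dimension, f ↦ ∑ f(t₂) t₁ is bijective; λ is the preimage of 1. It is an integral since p * λ
and p(1) λ have the same image. -/
theorem exists_isIntegralPair [FiniteDimensional k H] :
    ∃ (lam : H →ₗ[k] k) (t : H), IsIntegralPair lam t := by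
  obtain ⟨t, ht0, ht⟩ := exists_isLeftIntegral (k := k) (H := H)
  have hinj := ht.dualToSelf_injective ht0
  have hsurj : Function.Surjective (dualToSelf k t) :=
    (LinearMap.injective_iff_surjective_of_finrank_eq_finrank Subspace.dual_finrank_eq).mp hinj
  obtain ⟨lam, hl⟩ := hsurj 1
  rw [dualToSelf_apply] at hl
  refine ⟨lam, t, ht, fun x => ?_, ?_, hinj⟩
  · refine eq_of_forall_dual (k := k) fun p => ?_
    have h : (toConv p * toConv lam : WithConv (H →ₗ[k] k)).ofConv = p 1 • lam := by
      apply hinj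
      rw [map_smul, dualToSelf_apply, dualToSelf_apply, rhit_convMul, hl]
      simp [rhit, Bialgebra.comul_one, Algebra.TensorProduct.one_def]
    rw [apply_rhit]
    refine (LinearMap.congr_fun h x).trans ?_
    simp [Algebra.algebraMap_eq_smul_one, mul_comm]
  · have := congrArg (counit (R := k)) hl
    rw [rhit_apply _ (ℛ k t)] at this
    have h2 := congrArg lam (lhit_counit (k := k) t)
    rw [lhit_apply _ (ℛ k t)] at h2
    rw [← h2]
    simpa [mul_comm] using this

namespace IsIntegralPair

variable {lam : H →ₗ[k] k} {t : H}

theorem apply_mul (hp : IsIntegralPair lam t) (x : H) : lam (x * t) = counit x := by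
  rw [hp.isLeftIntegral, map_smul, hp.apply_eq_one, smul_eq_mul, mul_one]

theorem rhit_eq_one (hp : IsIntegralPair lam t) : rhit lam t = 1 := by
  rw [hp.rhit_eq, hp.apply_eq_one, map_one]

theorem rhit_comp_mulLeft (hp : IsIntegralPair lam t) (x y : H) {ι : Type*}
    (r : Coalgebra.Repr k x ι) : rhit (lam ∘ₗ LinearMap.mulLeft k x) y =
      ∑ i ∈ r.index, lam (r.right i * y) • antipode k (r.left i) := by
  rw [HopfExponent.rhit_comp_mulLeft, r.convMul_apply]
  simp [hp.rhit_eq, Algebra.algebraMap_eq_smul_one]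

theorem rhit_comp_mulLeft_self (hp : IsIntegralPair lam t) (x : H) :
    rhit (lam ∘ₗ LinearMap.mulLeft k x) t = antipode k x := by
  rw [hp.isLeftIntegral.rhit_comp_mulLeft, hp.rhit_eq_one, mul_one]

/-- The functional λ(x ·) goes to S(x) under the injective map f ↦ ∑ f(t₂) t₁, and S is surjective.
Hence the form λ(xy) is nondegenerate. -/
theorem exists_eq_comp_mulLeft [FiniteDimensional k H] (hp : IsIntegralPair lam t)
    (f : H →ₗ[k] k) : ∃ x, f = lam ∘ₗ LinearMap.mulLeft k x := by
  obtain ⟨x, hx⟩ := (BijectiveAntipode.bijective (k := k) (H := H)).2 (rhit f t)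
  exact ⟨x, hp.injective (hx.symm.trans (hp.rhit_comp_mulLeft_self x).symm)⟩

theorem eq_zero_of_forall_apply_mul [FiniteDimensional k H] (hp : IsIntegralPair lam t) {y : H}
    (hy : ∀ x, lam (x * y) = 0) : y = 0 := by
  rw [← Module.forall_dual_apply_eq_zero_iff k]
  intro f
  obtain ⟨x, rfl⟩ := hp.exists_eq_comp_mulLeft f
  exact hy x

theorem exists_nakayama [FiniteDimensional k H] (hp : IsIntegralPair lam t) (x : H) :
    ∃ n, ∀ y, lam (x * y) = lam (y * n) := by
  let F : H →ₗ[k] (H →ₗ[k] k) := ((LinearMap.mul k H).compr₂ lam).flip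
  have hF (n y : H) : F n y = lam (y * n) := rfl
  have hinj : Function.Injective F := by
    rw [← LinearMap.ker_eq_bot, LinearMap.ker_eq_bot']
    intro n hn
    exact hp.eq_zero_of_forall_apply_mul fun y => by rw [← hF, hn, LinearMap.zero_apply]
  obtain ⟨n, hn⟩ := (LinearMap.injective_iff_surjective_of_finrank_eq_finrank
    Subspace.dual_finrank_eq.symm).mp hinj (lam ∘ₗ LinearMap.mulLeft k x)
  exact ⟨n, fun y => (LinearMap.congr_fun hn y).symm⟩

/-- Both sides pair with x under λ(x ·) to ε(x) λ(th), so nondegeneracy applies. -/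
theorem mul_eq_smul [FiniteDimensional k H] (hp : IsIntegralPair lam t) (h : H) :
    t * h = lam (t * h) • t := by
  rw [← sub_eq_zero]
  refine hp.eq_zero_of_forall_apply_mul fun x => ?_
  rw [mul_sub, map_sub, ← mul_assoc, hp.isLeftIntegral, smul_mul_assoc, mul_smul_comm, map_smul,
    map_smul, hp.apply_mul, smul_eq_mul, smul_eq_mul, mul_comm, sub_self]

/-- The distinguished character `h ↦ λ(t h)`, which satisfies `t h = α(h) t`. -/
noncomputable def char [FiniteDimensional k H] (hp : IsIntegralPair lam t) : H →ₐ[k] k :=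
  AlgHom.ofLinearMap (lam ∘ₗ LinearMap.mulLeft k t) (by simpa using hp.apply_eq_one)
    (fun a b => by
      simp only [LinearMap.comp_apply, LinearMap.mulLeft_apply]
      rw [← mul_assoc, hp.mul_eq_smul a, smul_mul_assoc, map_smul, map_smul, hp.apply_eq_one]
      simp)

theorem char_toLinearMap [FiniteDimensional k H] (hp : IsIntegralPair lam t) :
    hp.char.toLinearMap = lam ∘ₗ LinearMap.mulLeft k t := rfl

theorem lhit_eq (hp : IsIntegralPair lam t) (x : H) : lhit lam x = lam x • lhit lam t := by
  refine eq_of_forall_dual (k := k) fun p => ?_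
  have h : (toConv lam * toConv p : WithConv (H →ₗ[k] k)).ofConv = p (lhit lam t) • lam := by
    apply hp.injective
    rw [map_smul, dualToSelf_apply, dualToSelf_apply, rhit_convMul, hp.rhit_eq_one, hp.rhit_eq,
      apply_rhit, apply_lhit, Algebra.algebraMap_eq_smul_one]
  rw [apply_lhit]
  refine (LinearMap.congr_fun h x).trans ?_
  simp [mul_comm]

theorem isGroupLikeElem (hp : IsIntegralPair lam t) : IsGroupLikeElem k (lhit lam t) where
  counit_eq_one := by
    rw [apply_lhit, ← apply_rhit, rhit_counit, hp.apply_eq_one]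
  comul_eq_tmul_self := by
    have h (z : H ⊗[k] H) : (lhit lam).rTensor H z =
        lhit lam t ⊗ₜ TensorProduct.lid k H (lam.rTensor H z) := by
      induction z using TensorProduct.induction_on with
      | zero => simp
      | tmul a b => simp [hp.lhit_eq a, TensorProduct.smul_tmul]
      | add a b ha hb => simp only [map_add, ha, hb, TensorProduct.tmul_add]
    rw [comul_lhit, h]
    rfl

theorem antipode_lhit_comp_mulLeft (hp : IsIntegralPair lam t) (x y : H) {ι : Type*}
    (r : Coalgebra.Repr k x ι) : antipode k (lhit (lam ∘ₗ LinearMap.mulLeft k x) y) =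
      ∑ i ∈ r.index, lam (r.left i * y) • (antipode k (lhit lam t) * r.right i) := by
  rw [HopfExponent.antipode_lhit_comp_mulLeft, r.convMul_apply]
  refine Finset.sum_congr rfl fun i _ => ?_
  simp [hp.lhit_eq (r.left i * y)]

theorem antipode_lhit_comp_mulLeft_self (hp : IsIntegralPair lam t) (x : H) :
    antipode k (lhit (lam ∘ₗ LinearMap.mulLeft k x) t) = antipode k (lhit lam t) * x := by
  have h := congrArg (antipode k (lhit lam t) * ·) (lhit_counit (k := k) x)
  rw [lhit_apply _ (ℛ k x)] at h
  rw [hp.antipode_lhit_comp_mulLeft _ _ (ℛ k x), ← h]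
  simp [hp.apply_mul, Finset.mul_sum]

/-- S(x) = ∑ λ(xt₂) t₁ = ∑ λ(t₂n) t₁; applying S gives ∑ λ(t₂n) S(t₁) = ∑ λ(tn₂) n₁, where λ(t ·) is
the distinguished character. -/
theorem antipodeSq_eq [FiniteDimensional k H] (hp : IsIntegralPair lam t) {x n : H}
    (hn : ∀ y, lam (x * y) = lam (y * n)) :
    antipode k (antipode k x) = rhit hp.char.toLinearMap n := by
  rw [char_toLinearMap, hp.rhit_comp_mulLeft _ _ (ℛ k t), ← hp.rhit_comp_mulLeft_self x,
    rhit_apply _ (ℛ k t)]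
  simp [hn]

theorem antipodeSq_lhit [FiniteDimensional k H] (hp : IsIntegralPair lam t) {x n : H}
    (hn : ∀ y, lam (x * y) = lam (y * n)) :
    antipode k (antipode k (lhit hp.char.toLinearMap n)) =
      antipode k (lhit lam t) * x * lhit lam t := by
  rw [char_toLinearMap, hp.antipode_lhit_comp_mulLeft _ _ (ℛ k t),
    ← hp.antipode_lhit_comp_mulLeft_self x,
    lhit_apply (lam ∘ₗ LinearMap.mulLeft k x) (ℛ k t)]
  simp [hn, antipode_mul_antidistrib, Finset.sum_mul, hp.isGroupLikeElem]

end IsIntegralPair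

/-- Both α and α ∘ S² are convolution inverses of α ∘ S. -/
theorem algHom_antipode_antipode (α : H →ₐ[k] k) (x : H) :
    α (antipode k (antipode k x)) = α x := by
  have h1 : (toConv (α.toLinearMap ∘ₗ antipode k) * toConv α.toLinearMap :
      WithConv (H →ₗ[k] k)) = 1 := by
    ext x
    have := congrArg α (sum_antipode_mul_eq_smul (R := k) (ℛ k x))
    rw [(ℛ k x).convMul_apply]
    simpa using this
  have h2 : (toConv (α.toLinearMap ∘ₗ antipode k ∘ₗ antipode k) *
      toConv (α.toLinearMap ∘ₗ antipode k) : WithConv (H →ₗ[k] k)) = 1 := by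
    ext x
    have := congrArg (fun z => α (antipode k z)) (sum_antipode_mul_eq_smul (R := k) (ℛ k x))
    rw [(ℛ k x).convMul_apply]
    simpa [antipode_mul_antidistrib, mul_comm] using this
  have h3 := left_inv_eq_right_inv h2 h1
  exact LinearMap.congr_fun (toConv_injective h3) x

theorem lhit_antipodeSq [BijectiveAntipode k H] (α : H →ₐ[k] k) (x : H) :
    lhit α.toLinearMap (antipodeSq k H x) = antipodeSq k H (lhit α.toLinearMap x) := by
  have h := LinearMap.congr_fun (comul_comp_antipodeSq (k := k) (H := H)) x
  simp only [LinearMap.comp_apply, AlgEquiv.toLinearMap_apply] at h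
  rw [lhit_apply _ (ℛ k x), lhit, LinearMap.comp_apply, LinearMap.comp_apply, h, ← (ℛ k x).eq]
  simp [algHom_antipode_antipode]

theorem rhit_antipodeSq [BijectiveAntipode k H] (α : H →ₐ[k] k) (x : H) :
    rhit α.toLinearMap (antipodeSq k H x) = antipodeSq k H (rhit α.toLinearMap x) := by
  have h := LinearMap.congr_fun (comul_comp_antipodeSq (k := k) (H := H)) x
  simp only [LinearMap.comp_apply, AlgEquiv.toLinearMap_apply] at h
  rw [rhit_apply _ (ℛ k x), rhit, LinearMap.comp_apply, LinearMap.comp_apply, h, ← (ℛ k x).eq]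
  simp [algHom_antipode_antipode]

/-- Radford's formula for the fourth power of the antipode:
`∑ α(x₁) S⁴(x₂) = ∑ α(x₂) S(g) x₁ g` for some character `α` and some grouplike element `g`. -/
theorem exists_radford (k H : Type*) [Field k] [Ring H] [HopfAlgebra k H] [FiniteDimensional k H] :
    ∃ (α : H →ₐ[k] k) (g : H), IsGroupLikeElem k g ∧
      ∀ x, lhit α.toLinearMap (antipodeSq k H (antipodeSq k H x)) =
        rhit α.toLinearMap (antipode k g * x * g) := by
  obtain ⟨lam, t, hp⟩ := exists_isIntegralPair (k := k) (H := H)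
  refine ⟨hp.char, lhit lam t, hp.isGroupLikeElem, fun x => ?_⟩
  obtain ⟨n, hn⟩ := hp.exists_nakayama x
  -- The Nakayama image n of x is eliminated between S²(x) = ∑ α(n₂) n₁ and S²(∑ α(n₁) n₂) = S(g) x
  -- g, as the two actions of α commute with each other and with S².
  rw [lhit_antipodeSq, antipodeSq_apply x, hp.antipodeSq_eq hn, lhit_rhit, ← rhit_antipodeSq,
    antipodeSq_apply, hp.antipodeSq_lhit hn]

end Integral

/-! ## The convolution algebra `Hom(H, End(H))` -/

section Convolution

variable {k H : Type*} [Field k] [Ring H] [HopfAlgebra k H]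

theorem algEquiv_pow_apply_eq_self {τ : H ≃ₐ[k] H} {x : H} (h : τ x = x) (n : ℕ) :
    (τ ^ n) x = x := by
  induction n with
  | zero => rfl
  | succ n ih => rw [pow_succ, AlgEquiv.mul_apply, h, ih]

theorem apply_algEquiv_pow_apply {V : Type*} {τ : H ≃ₐ[k] H} {f : H → V}
    (h : ∀ x, f (τ x) = f x) (n : ℕ) (x : H) : f ((τ ^ n) x) = f x := by
  induction n generalizing x with
  | zero => rfl
  | succ n ih => rw [pow_succ, AlgEquiv.mul_apply, ih, h]

theorem apply_algEquiv_pow_apply_comm {τ : H ≃ₐ[k] H} {f : H → H}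
    (h : ∀ x, f (τ x) = τ (f x)) (n : ℕ) (x : H) : f ((τ ^ n) x) = (τ ^ n) (f x) := by
  induction n generalizing x with
  | zero => rfl
  | succ n ih => rw [pow_succ, AlgEquiv.mul_apply, ih, h, AlgEquiv.mul_apply]

/-- `h ↦ (x ↦ h τ(x))` in the convolution algebra `Hom(H, End(H))`. -/
noncomputable def mulTwist (τ : H ≃ₐ[k] H) : WithConv (H →ₗ[k] Module.End k H) :=
  toConv (LinearMap.mulRight k (τ.toLinearMap : Module.End k H) ∘ₗ (Algebra.lmul k H).toLinearMap)

theorem mulTwist_apply (τ : H ≃ₐ[k] H) (h x : H) : mulTwist τ h x = h * τ x := rfl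

theorem mulTwist_pow_apply (τ : H ≃ₐ[k] H) (n : ℕ) (h x : H) :
    (mulTwist τ ^ n) h x = twistedPower τ n h * (τ ^ n) x := by
  induction n generalizing h x with
  | zero =>
    rw [pow_zero, pow_zero, twistedPower_zero, LinearMap.convOne_apply, LinearMap.convOne_apply]
    simp [Algebra.algebraMap_eq_smul_one]
  | succ n ih =>
    rw [pow_succ, twistedPower_succ, (ℛ k h).convMul_apply, (ℛ k h).convMul_apply,
      LinearMap.sum_apply, Finset.sum_mul]
    refine Finset.sum_congr rfl fun i _ => ?_
    rw [Module.End.mul_apply, ih, mulTwist_apply, map_mul, mul_assoc, pow_succ]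
    rfl

/-- The constant element `h ↦ ε(h) X`. -/
noncomputable def constEnd (X : Module.End k H) : WithConv (H →ₗ[k] Module.End k H) :=
  toConv (LinearMap.toSpanSingleton k _ X ∘ₗ counit)

theorem constEnd_apply (X : Module.End k H) (h : H) :
    constEnd X h = (counit h : k) • X := rfl

theorem constEnd_mul_apply (X : Module.End k H) (F : WithConv (H →ₗ[k] Module.End k H)) (h : H) :
    (constEnd X * F) h = X * F h := by
  have := congrArg (fun z => X * F z) (lhit_counit (k := k) h)
  rw [lhit_apply _ (ℛ k h)] at this
  rw [(ℛ k h).convMul_apply, ← this]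
  simp [constEnd_apply, Finset.mul_sum]

theorem mul_constEnd_apply (X : Module.End k H) (F : WithConv (H →ₗ[k] Module.End k H)) (h : H) :
    (F * constEnd X) h = F h * X := by
  have := congrArg (fun z => F z * X) (rhit_counit (k := k) h)
  rw [rhit_apply _ (ℛ k h)] at this
  rw [(ℛ k h).convMul_apply, ← this]
  simp [constEnd_apply, Finset.sum_mul]

theorem constEnd_one : constEnd (1 : Module.End k H) = 1 := by
  ext h : 2
  rw [constEnd_apply, LinearMap.convOne_apply, Algebra.algebraMap_eq_smul_one]

theorem constEnd_mul_constEnd (X Y : Module.End k H) :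
    constEnd X * constEnd Y = constEnd (X * Y) := by
  refine ofConv_injective (LinearMap.ext fun h => ?_)
  rw [constEnd_mul_apply, constEnd_apply, constEnd_apply, mul_smul_comm]

theorem constEnd_pow (X : Module.End k H) (n : ℕ) : constEnd X ^ n = constEnd (X ^ n) := by
  induction n with
  | zero => rw [pow_zero, pow_zero, constEnd_one]
  | succ n ih => rw [pow_succ, pow_succ, ih, constEnd_mul_constEnd]

/-- The scalar element `h ↦ f(h) 1`. -/
noncomputable def scalarEnd (f : H →ₗ[k] k) : WithConv (H →ₗ[k] Module.End k H) :=
  toConv (Algebra.linearMap k _ ∘ₗ f)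

theorem scalarEnd_apply (f : H →ₗ[k] k) (h : H) :
    scalarEnd f h = f h • (1 : Module.End k H) :=
  Algebra.algebraMap_eq_smul_one (A := Module.End k H) (f h)

theorem scalarEnd_mul_apply (f : H →ₗ[k] k) (F : WithConv (H →ₗ[k] Module.End k H)) (h : H) :
    (scalarEnd f * F) h = F (lhit f h) := by
  rw [(ℛ k h).convMul_apply, lhit_apply _ (ℛ k h)]
  simp [scalarEnd_apply]

theorem mul_scalarEnd_apply (f : H →ₗ[k] k) (F : WithConv (H →ₗ[k] Module.End k H)) (h : H) :
    (F * scalarEnd f) h = F (rhit f h) := by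
  rw [(ℛ k h).convMul_apply, rhit_apply _ (ℛ k h)]
  simp [scalarEnd_apply]

theorem scalarEnd_commute_constEnd (f : H →ₗ[k] k) (X : Module.End k H) :
    Commute (scalarEnd f) (constEnd X) := by
  refine ofConv_injective (LinearMap.ext fun h => ?_)
  rw [mul_constEnd_apply, constEnd_mul_apply, scalarEnd_apply, smul_one_mul, mul_smul_one]

theorem scalarEnd_mul_scalarEnd (p f : H →ₗ[k] k) : scalarEnd p * scalarEnd f =
    scalarEnd (toConv p * toConv f : WithConv (H →ₗ[k] k)).ofConv := by
  refine ofConv_injective (LinearMap.ext fun h => ?_)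
  rw [scalarEnd_mul_apply, scalarEnd_apply, scalarEnd_apply, apply_lhit]

theorem scalarEnd_one : scalarEnd (1 : WithConv (H →ₗ[k] k)).ofConv = 1 := rfl

/-- Under the hypothesis F_τⁿ is the constant τⁿ, and it commutes with F_τ. Evaluating both products
at x and then at 1 gives x = τⁿ(x). -/
theorem pow_eq_one_of_twistedPower_eq_one {τ : H ≃ₐ[k] H} {n : ℕ} (h : twistedPower τ n = 1) :
    τ ^ n = 1 := by
  have hc : mulTwist τ ^ n = constEnd (τ ^ n).toLinearMap := by
    refine ofConv_injective (LinearMap.ext fun x => LinearMap.ext fun y => ?_)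
    rw [mulTwist_pow_apply, h, LinearMap.convOne_apply, constEnd_apply, ← Algebra.smul_def]
    rfl
  have hcomm := (Commute.refl (mulTwist τ)).pow_right n
  rw [hc] at hcomm
  ext x
  have hx := congrArg (fun F : WithConv (H →ₗ[k] Module.End k H) => F x 1) hcomm.eq
  rw [mul_constEnd_apply, constEnd_mul_apply, Module.End.mul_apply, Module.End.mul_apply,
    mulTwist_apply, mulTwist_apply] at hx
  simpa using hx.symm

theorem mulTwist_pow_eq_one_iff (τ : H ≃ₐ[k] H) (n : ℕ) :
    mulTwist τ ^ n = 1 ↔ twistedPower τ n = 1 := by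
  constructor
  · intro h
    ext x
    have hx := congrArg (fun F : WithConv (H →ₗ[k] Module.End k H) => F x 1) h
    rw [mulTwist_pow_apply, map_one, mul_one, LinearMap.convOne_apply] at hx
    rw [hx, LinearMap.convOne_apply, Algebra.algebraMap_eq_smul_one, Algebra.algebraMap_eq_smul_one]
    rfl
  · intro h
    refine ofConv_injective (LinearMap.ext fun x => LinearMap.ext fun y => ?_)
    rw [mulTwist_pow_apply, h, pow_eq_one_of_twistedPower_eq_one h, LinearMap.convOne_apply,
      LinearMap.convOne_apply, ← Algebra.smul_def, Algebra.algebraMap_eq_smul_one]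
    rfl

theorem twistedPower_apply_isGroupLikeElem {τ : H ≃ₐ[k] H} {g : H} (hg : IsGroupLikeElem k g)
    (hτ : τ g = g) (n : ℕ) : twistedPower τ n g = g ^ n := by
  induction n with
  | zero => rw [twistedPower_zero, LinearMap.convOne_apply, hg.counit_eq_one, map_one, pow_zero]
  | succ n ih =>
    rw [twistedPower_succ, LinearMap.convMul_apply, hg.comul_eq_tmul_self, TensorProduct.map_tmul,
      LinearMap.mul'_apply, ih, pow_succ]
    exact congrArg _ (algEquiv_pow_apply_eq_self hτ n)

theorem rhit_algHom_mul (β : H →ₐ[k] k) (x y : H) :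
    rhit β.toLinearMap (x * y) = rhit β.toLinearMap x * rhit β.toLinearMap y := by
  rw [rhit_mul, rhit_apply _ (ℛ k x), rhit_apply _ (ℛ k y), Finset.sum_mul_sum]
  simp [smul_smul, mul_comm]

theorem rhit_isGroupLikeElem (f : H →ₗ[k] k) {g : H} (hg : IsGroupLikeElem k g) :
    rhit f g = f g • g := by
  simp [rhit, hg.comul_eq_tmul_self]

/-- The convolution inverse of a character. -/
noncomputable def charInv (α : H →ₐ[k] k) : H →ₐ[k] k :=
  AlgHom.ofLinearMap (α.toLinearMap ∘ₗ antipode k) (by simp)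
    (fun x y => by simp [antipode_mul_antidistrib, mul_comm])

theorem charInv_apply (α : H →ₐ[k] k) (x : H) : charInv α x = α (antipode k x) := rfl

theorem charInv_convMul (α : H →ₐ[k] k) :
    (toConv (charInv α).toLinearMap * toConv α.toLinearMap : WithConv (H →ₗ[k] k)) = 1 := by
  ext x
  have := congrArg α (sum_antipode_mul_eq_smul (R := k) (ℛ k x))
  rw [(ℛ k x).convMul_apply]
  simpa [charInv_apply] using this

theorem convMul_charInv (α : H →ₐ[k] k) :
    (toConv α.toLinearMap * toConv (charInv α).toLinearMap : WithConv (H →ₗ[k] k)) = 1 := by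
  ext x
  have := congrArg α (sum_mul_antipode_eq_smul (R := k) (ℛ k x))
  rw [(ℛ k x).convMul_apply]
  simpa [charInv_apply] using this

theorem scalarEnd_pow {τ : H ≃ₐ[k] H} {α : H →ₐ[k] k} (hα : ∀ x, α (τ x) = α x) (n : ℕ) :
    scalarEnd α.toLinearMap ^ n = scalarEnd (α.toLinearMap ∘ₗ (twistedPower τ n).ofConv) := by
  induction n with
  | zero =>
    rw [pow_zero, twistedPower_zero, ← scalarEnd_one]
    congr 1
    ext x
    simp
  | succ n ih =>
    rw [pow_succ, ih, scalarEnd_mul_scalarEnd, twistedPower_succ]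
    congr 1
    ext x
    rw [(ℛ k x).convMul_apply, LinearMap.comp_apply, (ℛ k x).convMul_apply]
    simp only [AlgHom.toLinearMap_apply, map_sum, map_mul, LinearMap.comp_apply]
    refine Finset.sum_congr rfl fun i _ => ?_
    exact congrArg _ (apply_algEquiv_pow_apply hα n _).symm

/-- A single factor sends h and x to a multiple of `rhit β (h * u) * τ x`. Because `rhit β` is
multiplicative and commutes with τ, and u is a grouplike fixed by τ, these factors multiply as those
of Pₙ(τ) do. -/
theorem mulTwist_mul_pow_apply {τ : H ≃ₐ[k] H} {β : H →ₐ[k] k}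
    (hβ : ∀ x, rhit β.toLinearMap (τ x) = τ (rhit β.toLinearMap x)) {u : H}
    (hu : IsGroupLikeElem k u) (hτu : τ u = u) (n : ℕ) (h x : H) :
    ((mulTwist τ * scalarEnd β.toLinearMap * constEnd (LinearMap.mulLeft k u)) ^ n) h x =
      (β (antipode k u)) ^ n • (rhit β.toLinearMap (twistedPower τ n (h * u)) * (τ ^ n) x) := by
  have hone : rhit β.toLinearMap 1 = 1 := by
    simp [rhit, Bialgebra.comul_one, Algebra.TensorProduct.one_def]
  have hβu : β (antipode k u) * β u = 1 := by
    rw [← map_mul, hu.antipode_mul_cancel, map_one]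
  have hy (h x : H) :
      (mulTwist τ * scalarEnd β.toLinearMap * constEnd (LinearMap.mulLeft k u)) h x =
        β (antipode k u) • (rhit β.toLinearMap (h * u) * τ x) := by
    rw [mul_constEnd_apply, mul_scalarEnd_apply, Module.End.mul_apply, mulTwist_apply,
      LinearMap.mulLeft_apply, map_mul, hτu, rhit_algHom_mul, rhit_isGroupLikeElem _ hu]
    simp [smul_smul, hβu, mul_assoc]
  induction n generalizing h x with
  | zero =>
    rw [pow_zero, pow_zero, pow_zero, twistedPower_zero, LinearMap.convOne_apply,
      LinearMap.convOne_apply, Bialgebra.counit_mul, hu.counit_eq_one]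
    simp [Algebra.algebraMap_eq_smul_one, hone]
  | succ n ih =>
    have e : twistedPower τ (n + 1) (h * u) = ∑ i ∈ (ℛ k h).index,
        twistedPower τ n ((ℛ k h).left i * u) * (τ ^ n) ((ℛ k h).right i * u) := by
      rw [twistedPower_succ, LinearMap.convMul_apply, Bialgebra.comul_mul, hu.comul_eq_tmul_self]
      conv_lhs => rw [← (ℛ k h).eq]
      simp [Finset.sum_mul]
    rw [pow_succ, (ℛ k h).convMul_apply, LinearMap.sum_apply, e, map_sum, Finset.sum_mul,
      Finset.smul_sum]
    refine Finset.sum_congr rfl fun i _ => ?_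
    rw [Module.End.mul_apply, hy, map_smul, ih, map_mul (τ ^ n),
      rhit_algHom_mul β (twistedPower τ n _),
      apply_algEquiv_pow_apply_comm hβ, smul_smul,
      ← pow_succ', mul_assoc, pow_succ τ, AlgEquiv.mul_apply]

end Convolution

/-! ### Reduction to two automorphisms, and the least common multiple -/

section Exponent

variable {k H : Type*} [Field k] [Ring H] [HopfAlgebra k H] [FiniteDimensional k H]

theorem twistedPower_add_two {N m : ℕ} (hσ : antipodeSq k H ^ N = 1)
    (h : twistedPower (antipodeSq k H ^ m) N = 1) :
    twistedPower (antipodeSq k H ^ (m + 2)) N = 1 := by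
  obtain ⟨α, g, hg, hR⟩ := exists_radford k H
  set σ := antipodeSq k H with hσdef
  set τ := σ ^ m with hτdef
  have hSg := hg.antipode
  have hσg : σ g = g := by simp [hσdef, hg]
  have hσSg : σ (antipode k g) = antipode k g := by simp [hσdef, hg]
  have hτg : τ g = g := algEquiv_pow_apply_eq_self hσg m
  have hτSg : τ (antipode k g) = antipode k g := algEquiv_pow_apply_eq_self hσSg m
  have hτα (x : H) : α (τ x) = α x :=
    apply_algEquiv_pow_apply (algHom_antipode_antipode α) m x
  have hβ : ∀ x, rhit (charInv α).toLinearMap (τ x) = τ (rhit (charInv α).toLinearMap x) :=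
    apply_algEquiv_pow_apply_comm (rhit_antipodeSq (charInv α)) m
  have hpow {u : H} (hu : IsGroupLikeElem k u) (hτu : τ u = u) : u ^ N = 1 := by
    rw [← twistedPower_apply_isGroupLikeElem hu hτu, h, LinearMap.convOne_apply,
      hu.counit_eq_one, map_one]
  let f := mulTwist τ
  let c := constEnd (LinearMap.mulLeft k g)
  let c' := constEnd (LinearMap.mulLeft k (antipode k g))
  let a := scalarEnd α.toLinearMap
  let a' := scalarEnd (charInv α).toLinearMap
  let s := constEnd ((σ ^ 2).toLinearMap : Module.End k H)
  have hfs : mulTwist (σ ^ (m + 2)) = f * s := by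
    refine ofConv_injective (LinearMap.ext fun x => LinearMap.ext fun y => ?_)
    rw [mul_constEnd_apply, mulTwist_apply, pow_add, Module.End.mul_apply, mulTwist_apply]
    rfl
  have hcc' : c * c' = 1 := by
    rw [constEnd_mul_constEnd, ← constEnd_one]
    congr 1
    ext x
    simp [← mul_assoc, hg]
  have hc'c : c' * c = 1 := by
    rw [constEnd_mul_constEnd, ← constEnd_one]
    congr 1
    ext x
    simp [← mul_assoc, hg]
  have haa' : a * a' = 1 := by
    rw [scalarEnd_mul_scalarEnd, ← scalarEnd_one]
    exact congrArg (fun z => scalarEnd (ofConv z)) (convMul_charInv α)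
  have ha'a : a' * a = 1 := by
    rw [scalarEnd_mul_scalarEnd, ← scalarEnd_one]
    exact congrArg (fun z => scalarEnd (ofConv z)) (charInv_convMul α)
  have hsc {u : H} (hσu : σ u = u) : Commute s (constEnd (LinearMap.mulLeft k u)) := by
    change _ * _ = _ * _
    rw [constEnd_mul_constEnd, constEnd_mul_constEnd]
    congr 1
    ext x
    change (σ ^ 2) (u * x) = u * (σ ^ 2) x
    rw [map_mul, algEquiv_pow_apply_eq_self hσu]
  have hac (u : H) : Commute a (constEnd (LinearMap.mulLeft k u)) :=
    scalarEnd_commute_constEnd _ _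
  have ha'c (u : H) : Commute a' (constEnd (LinearMap.mulLeft k u)) :=
    scalarEnd_commute_constEnd _ _
  have has : Commute a s := scalarEnd_commute_constEnd _ _
  have ha's : Commute a' s := scalarEnd_commute_constEnd _ _
  -- This is Radford's formula, rewritten as g S⁴(∑ α(x₁) x₂) = (∑ α(x₂) x₁) g.
  have hwf : Commute (c * a * s) f := by
    refine ofConv_injective (LinearMap.ext fun x => LinearMap.ext fun y => ?_)
    have hlr : g * (σ ^ 2) (lhit α.toLinearMap x) = rhit α.toLinearMap x * g := by
      have h1 := hR x
      rw [lhit_antipodeSq, lhit_antipodeSq, rhit_algHom_mul, rhit_algHom_mul,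
        rhit_isGroupLikeElem _ hg, rhit_isGroupLikeElem _ hSg] at h1
      have hα : α g * α (antipode k g) = 1 := by
        rw [← map_mul, hg.mul_antipode_cancel, map_one]
      have h2 : (σ ^ 2) (lhit α.toLinearMap x) = antipode k g * rhit α.toLinearMap x * g := by
        rw [pow_two, AlgEquiv.mul_apply]
        refine h1.trans ?_
        simp [smul_smul, hα]
      rw [h2, ← mul_assoc, ← mul_assoc, hg.mul_antipode_cancel, one_mul]
    have hcomm : (σ ^ 2) (τ y) = τ ((σ ^ 2) y) := by
      rw [← AlgEquiv.mul_apply, ← AlgEquiv.mul_apply, hτdef, ← pow_add, ← pow_add, add_comm]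
    have e1 : (c * a * s * f) x y = g * (σ ^ 2) (lhit α.toLinearMap x * τ y) := by
      rw [mul_assoc, mul_assoc, constEnd_mul_apply, scalarEnd_mul_apply, constEnd_mul_apply]
      rfl
    have e2 : (f * (c * a * s)) x y = rhit α.toLinearMap x * τ (g * (σ ^ 2) y) := by
      rw [(hac g).symm.eq, ← mul_assoc, ← mul_assoc, mul_constEnd_apply, mul_constEnd_apply,
        mul_scalarEnd_apply]
      rfl
    rw [e1, e2, map_mul, map_mul, hτg, ← mul_assoc, ← mul_assoc, hlr, hcomm]
  have hwa' : Commute (c * a * s) a' :=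
    ((ha'c g).symm.mul_left (haa'.trans ha'a.symm)).mul_left ha's.symm
  have hwc' : Commute (c * a * s) c' :=
    (Commute.mul_left (hcc'.trans hc'c.symm) (hac _)).mul_left (hsc hσSg)
  have hfs' : f * s = (f * a' * c') * (c * a * s) := by
    calc f * s = f * (a' * ((c' * c) * a)) * s := by rw [hc'c, one_mul, ha'a, mul_one]
      _ = _ := by simp only [mul_assoc]
  have hw : (c * a * s) ^ N = 1 := by
    have hcN : c ^ N = 1 := by
      rw [constEnd_pow, ← constEnd_one, LinearMap.pow_mulLeft, hpow hg hτg, LinearMap.mulLeft_one]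
      rfl
    have haN : a ^ N = 1 := by
      rw [scalarEnd_pow hτα, h, ← scalarEnd_one]
      congr 1
      ext x
      simp
    have hsN : s ^ N = 1 := by
      rw [constEnd_pow, ← constEnd_one]
      congr 1
      have : ((σ ^ 2).toLinearMap : Module.End k H) ^ N = ((σ ^ 2) ^ N).toLinearMap :=
        (map_pow (AlgEquiv.toLinearMapHom k H) (σ ^ 2) N).symm
      rw [this, ← pow_mul, mul_comm, pow_mul, hσ, one_pow]
      rfl
    rw [Commute.mul_pow ((hsc hσg).symm.mul_left has), Commute.mul_pow (hac g).symm, hcN, haN, hsN,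
      one_mul, one_mul]
  -- Here u = S(g), so the scalar is α⁻¹(S²(g))ᴺ = α⁻¹(gᴺ) = 1.
  have hy : (f * a' * c') ^ N = 1 := by
    refine ofConv_injective (LinearMap.ext fun x => LinearMap.ext fun y => ?_)
    rw [mulTwist_mul_pow_apply hβ hSg hτSg, h, pow_eq_one_of_twistedPower_eq_one h,
      LinearMap.convOne_apply, LinearMap.convOne_apply, Bialgebra.counit_mul, hSg.counit_eq_one,
      ← map_pow, hg.antipode_antipode, hpow hg hτg]
    simp [Algebra.algebraMap_eq_smul_one, rhit, Bialgebra.comul_one,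
      Algebra.TensorProduct.one_def]
  rw [← mulTwist_pow_eq_one_iff, hfs, hfs',
    Commute.mul_pow ((hwf.mul_right hwa').mul_right hwc').symm, hy, hw, one_mul]

theorem twistedPower_eq_one_of_mem_zpowers {N : ℕ} (hN : 1 ≤ N)
    (h₀ : twistedPower (1 : H ≃ₐ[k] H) N = 1) (h₁ : twistedPower (antipodeSq k H)⁻¹ N = 1)
    {τ : H ≃ₐ[k] H} (hτ : τ ∈ Subgroup.zpowers (antipodeSq k H)) : twistedPower τ N = 1 := by
  have hσ : antipodeSq k H ^ N = 1 := by
    rw [← inv_inj, ← inv_pow, pow_eq_one_of_twistedPower_eq_one h₁, inv_one]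
  have heven (i : ℕ) : twistedPower (antipodeSq k H ^ (2 * i)) N = 1 := by
    induction i with
    | zero => exact h₀
    | succ i ih => exact twistedPower_add_two hσ ih
  -- As σᴺ = 1, the inverse σ⁻¹ is the odd natural power σ²ᴺ⁻¹. Odd exponents below 2N - 1 are
  -- recovered later by a shift by 2N.
  have hodd (i : ℕ) : twistedPower (antipodeSq k H ^ (2 * N - 1 + 2 * i)) N = 1 := by
    induction i with
    | zero =>
      have : antipodeSq k H ^ (2 * N - 1 + 2 * 0) = (antipodeSq k H)⁻¹ := by
        rw [eq_inv_iff_mul_eq_one, ← pow_succ, show 2 * N - 1 + 2 * 0 + 1 = N * 2 by lia, pow_mul,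
          hσ, one_pow]
      rw [this, h₁]
    | succ i ih => exact twistedPower_add_two hσ ih
  obtain ⟨n, rfl⟩ := (isOfFinOrder_iff_pow_eq_one.mpr ⟨N, hN, hσ⟩).mem_powers_iff_mem_zpowers.mpr hτ
  rcases Nat.even_or_odd' n with ⟨i, rfl | rfl⟩
  · exact heven i
  · have := hodd (i + 1)
    rwa [show 2 * N - 1 + 2 * (i + 1) = N * 2 + (2 * i + 1) by lia, pow_add, pow_mul, hσ, one_pow,
      one_mul] at this

/-- The number d will be an `orderOf`, whose value 0 for infinite order corresponds to the exponent
∞. -/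
theorem sInf_multiples (d : ℕ) :
    sInf ((fun n : ℕ => (n : ℕ∞)) '' {n | 1 ≤ n ∧ d ∣ n}) = if d = 0 then ⊤ else (d : ℕ∞) := by
  split_ifs with hd
  · subst hd
    have : {n : ℕ | 1 ≤ n ∧ 0 ∣ n} = ∅ := by
      ext n
      simp only [zero_dvd_iff, Set.mem_ofPred_eq, Set.mem_empty_iff_false]
      lia
    rw [this, Set.image_empty, sInf_empty]
  · refine IsLeast.csInf_eq ⟨⟨d, ⟨Nat.one_le_iff_ne_zero.mpr hd, dvd_rfl⟩, rfl⟩, ?_⟩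
    rintro _ ⟨n, ⟨hn, hdn⟩, rfl⟩
    exact Nat.cast_le.mpr (Nat.le_of_dvd hn hdn)

theorem lcmTop_top_left (a : ℕ∞) : lcmTop ⊤ a = ⊤ := rfl

theorem lcmTop_top_right (a : ℕ∞) : lcmTop a ⊤ = ⊤ := by
  cases a <;> rfl

theorem lcmTop_sInf_multiples (a b : ℕ) :
    lcmTop (sInf ((fun n : ℕ => (n : ℕ∞)) '' {n | 1 ≤ n ∧ a ∣ n}))
      (sInf ((fun n : ℕ => (n : ℕ∞)) '' {n | 1 ≤ n ∧ b ∣ n})) =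
      sInf ((fun n : ℕ => (n : ℕ∞)) '' {n | 1 ≤ n ∧ Nat.lcm a b ∣ n}) := by
  rw [sInf_multiples, sInf_multiples, sInf_multiples]
  rcases eq_or_ne a 0 with rfl | ha
  · rw [Nat.lcm_zero_left, if_pos rfl, lcmTop_top_left]
  rcases eq_or_ne b 0 with rfl | hb
  · rw [Nat.lcm_zero_right, if_pos rfl, lcmTop_top_right]
  rw [if_neg ha, if_neg hb, if_neg (Nat.lcm_ne_zero ha hb)]
  rfl

end Exponent

end HopfExponent

theorem corollary27 (k : Type*) (H : Type*) [Field k] [Ring H] [HopfAlgebra k H]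
    [FiniteDimensional k H] :
    HopfExponent.exponent k (HopfExponent.PivotalProduct k H) =
      HopfExponent.lcmTop (HopfExponent.exponent₀ k H) (HopfExponent.exponent k H) := by
  -- Each admissible set becomes the positive multiples of one number, so that the infima can be
  -- compared by divisibility.
  have h₀ (n : ℕ) : HopfExponent.sweedlerPower k H n = HopfExponent.trivialMap k H ↔
      orderOf (HopfExponent.mulTwist (1 : H ≃ₐ[k] H)) ∣ n := by
    rw [HopfExponent.sweedlerPower_eq_trivialMap_iff, ← HopfExponent.mulTwist_pow_eq_one_iff,
      orderOf_dvd_iff_pow_eq_one]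
  have h₁ (n : ℕ) : HopfExponent.twistedSweedlerPower k H n = HopfExponent.trivialMap k H ↔
      orderOf (HopfExponent.mulTwist (HopfExponent.antipodeSq k H)⁻¹) ∣ n := by
    rw [HopfExponent.twistedSweedlerPower_eq_trivialMap_iff,
      ← HopfExponent.mulTwist_pow_eq_one_iff, orderOf_dvd_iff_pow_eq_one]
  have h (n : ℕ) : (1 ≤ n ∧ HopfExponent.twistedSweedlerPower k (HopfExponent.PivotalProduct k H) n
        = HopfExponent.trivialMap k (HopfExponent.PivotalProduct k H)) ↔
      (1 ≤ n ∧ Nat.lcm (orderOf (HopfExponent.mulTwist (1 : H ≃ₐ[k] H)))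
        (orderOf (HopfExponent.mulTwist (HopfExponent.antipodeSq k H)⁻¹)) ∣ n) := by
    refine and_congr_right fun hn => ?_
    rw [Nat.lcm_dvd_iff, ← h₀, ← h₁, HopfExponent.twistedSweedlerPower_pivotalProduct_iff,
      HopfExponent.sweedlerPower_eq_trivialMap_iff,
      HopfExponent.twistedSweedlerPower_eq_trivialMap_iff]
    constructor
    · exact fun hτ => ⟨(hτ _ (one_mem _)).1, (hτ _ (inv_mem (Subgroup.mem_zpowers _))).1⟩
    · intro hτ τ hmem
      have := HopfExponent.twistedPower_eq_one_of_mem_zpowers hn hτ.1 hτ.2 hmem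
      exact ⟨this, HopfExponent.pow_eq_one_of_twistedPower_eq_one this⟩
  unfold HopfExponent.exponent HopfExponent.exponent₀
  simp only [h₀, h₁, h]
  exact (HopfExponent.lcmTop_sInf_multiples _ _).symm
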